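/- **Setting.** A typical user sits at the origin of the plane. Terrestrial base stations (TBSs) form a homogeneous Poisson process of density $\lambda_T>0$ on $\mathbb R^2$; they are numbered $x_{T,0},x_{T,1},\dots$ by increasing distance $R_{T,0}<R_{T,1}<\cdots$ from the user. TBS $i$ has a channel gain $H_{T,i}$ with law $\Gamma(m_T,1/m_T)$ (shape $m_T$, scale $1/m_T$), $m_T\ge 1$ an integer, and, as an interferer, a beamforming gain $G_i$ equal to $G_M$ with probability $p_M=\frac{\theta_a}{2\pi}\cdot\frac{\theta_d}{\pi}$ and to $G_m$ with probability $1-p_M$, where $G_M>0$, $G_m\ge 0$, $0<\theta_a\le 2\pi$, $0<\theta_d\le\pi$. Aerial base stations hover at height $h>0$; the horizontal locations of those in line of sight (LoS) and of the others (NLoS) form Poisson processes $\Phi_L,\Phi_N$ with intensities $\lambda_A P_L(\|x\|)\,dx$ and $\lambda_A(1-P_L(\|x\|))\,dx$, where $\lambda_A>0$ and $P_L$ is any measurable function with values in $[0,1]$ (for instance an S-curve). The TBS locations, the $H_{T,i}$, the $G_i$, $\Phi_L$ and $\Phi_N$ are independent, the $H_{T,i}$ are i.i.d. and the $G_i$ are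 i.i.d. Fix further positive constants $R_B,P_T,P_A,a_n,C_T,C_L,C_N,\alpha_T,\alpha_L,\alpha_N,\sigma_T^2,\nu_T$. Let $B_T$ be the event that the user is associated with a TBS: $R_{T,0}\le R_B$ and $G_MP_TC_TR_{T,0}^{-\alpha_T}$ exceeds $a_nP_AC_L(\|x\|^2+h^2)^{-\alpha_L/2}$ for all $x\in\Phi_L$ and $a_nP_AC_N(\|x\|^2+h^2)^{-\alpha_N/2}$ for all $x\in\Phi_N$. Let $$I_T=\sum_{i\ge1,\;R_{T,i}\le R_B}G_iP_TC_TR_{T,i}^{-\alpha_T}H_{T,i},\qquad P_T^C=\mathbb P\Big(\tfrac{G_MP_TC_TR_{T,0}^{-\alpha_T}H_{T,0}}{I_T+\sigma_T^2}\ge\nu_T\,\Big|\,B_T\Big),$$ $\varepsilon_T=\frac{\nu_T}{G_MP_TC_T}$, $b_T=m_T(m_T!)^{-1/m_T}$, and let $L_{I_T}(s)=L_{I_T}(s;r)=\mathbb E[e^{-sI_T}\mid R_{T,0}=r]$ be the Laplace transform of the interference when the nearest TBS is at distance $r$. **Lemma.** We have $\mathbb P(B_T)>0$; given $B_T$, the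 distance $R_{T,0}$ has a probability density $f_{\hat R_{T,0}}$; all integrals below converge absolutely; and the following hold. 1. (Exact expression.) $$P_T^C=\int_0^{R_B}\sum_{k=0}^{m_T-1}\sum_{p=0}^{k}\binom kp\frac{r^{\alpha_Tk}(m_T\varepsilon_T)^k}{k!}(\sigma_T^2)^pe^{-m_Tr^{\alpha_T}\varepsilon_T\sigma_T^2}\Big[(-1)^{k-p}\frac{\partial^{k-p}}{\partial s^{k-p}}L_{I_T}(s;r)\Big]_{s=m_T\varepsilon_Tr^{\alpha_T}}f_{\hat R_{T,0}}(r)\,dr.$$ 2. (Approximate expression.) For $b>0$ put $$A(b)=\int_0^{R_B}\sum_{k=1}^{m_T}(-1)^{k+1}\binom{m_T}{k}e^{-kbr^{\alpha_T}\varepsilon_T\sigma_T^2}L_{I_T}(kbr^{\alpha_T}\varepsilon_T;r)\,f_{\hat R_{T,0}}(r)\,dr.$$ Then $A(b_T)$ is exactly what $P_T^C$ becomes when the distribution function $\mathbb P(H_{T,0}<\tau)$ is replaced by $(1-e^{-b_T\tau})^{m_T}$, namely $$A(b_T)=\mathbb E\Big[1-\big(1-e^{-b_TR_{T,0}^{\alpha_T}\varepsilon_T(I_T+\sigma_T^2)}\big)^{m_T}\,\Big|\,B_T\Big],$$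 and it approximates $P_T^C$ in the sense that $$A(m_T)\le P_T^C\le A(b_T)$$ (so that there is equality throughout when $m_T=1$, since then $b_T=1=m_T$). -/

import Mathlib

open MeasureTheory ProbabilityTheory

namespace MmWave

noncomputable section

/-- The plane of horizontal locations; the typical user sits at the origin. -/
abbrev Plane : Type := EuclideanSpace ℝ (Fin 2)

/-! ### Poisson point processes -/

/-- Number of points of the random set `Φ` in the set `B`. -/
def pointCount {Ω E : Type*} (Φ : Ω → Set E) (B : Set E) (ω : Ω) : ℕ∞ := (Φ ω ∩ B).encard

/-- The σ-algebra on `Ω` generated by a random set of points, i.e. by its counting variables. -/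
abbrev pointSigma {Ω E : Type*} [MeasurableSpace E] (Φ : Ω → Set E) : MeasurableSpace Ω :=
  ⨆ B : {B : Set E // MeasurableSet B}, MeasurableSpace.comap (pointCount Φ B.1) inferInstance

/-- `Φ` is a (simple) Poisson point process with intensity measure `Λ`: the number of points in a
Borel set `B` with `Λ B < ∞` is Poisson with mean `Λ B`, and the numbers of points in finitely many
pairwise disjoint Borel sets are independent. -/
structure IsPoissonProcess {Ω E : Type*} [MeasurableSpace Ω] [MeasurableSpace E] (μ : Measure Ω)
    (Φ : Ω → Set E) (Λ : Measure E) : Prop where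
  measurable_count : ∀ B : Set E, MeasurableSet B → Measurable (pointCount Φ B)
  law_count : ∀ B : Set E, MeasurableSet B → Λ B ≠ ⊤ →
    μ.map (pointCount Φ B) = (poissonMeasure (Λ B).toNNReal).map (fun n : ℕ => (n : ℕ∞))
  indep_count : ∀ (n : ℕ) (B : Fin n → Set E), (∀ i, MeasurableSet (B i)) →
    Pairwise (Function.onFun Disjoint B) → iIndepFun (fun i => pointCount Φ (B i)) μ

/-! ### Deterministic parameters -/

/-- Parameters of the two-tier network (`T`: terrestrial mmWave base stations, `A`: aerial base
stations, whose links are line-of-sight `L` or non-line-of-sight `N`). -/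
structure Params where
  /-- densities of the two tiers -/
  lamT : ℝ
  lamA : ℝ
  /-- mmWave LoS radius and height of the aerial base stations -/
  RB : ℝ
  h : ℝ
  /-- transmit powers -/
  PT : ℝ
  PA : ℝ
  /-- NOMA power fraction of the near user -/
  an : ℝ
  /-- additive losses -/
  CT : ℝ
  CL : ℝ
  CN : ℝ
  /-- path loss exponents -/
  alphaT : ℝ
  alphaL : ℝ
  alphaN : ℝ
  /-- Nakagami parameter of the mmWave tier -/
  mT : ℕ
  /-- main-lobe and side-lobe gains, and the two beamwidths -/
  GM : ℝ
  Gm : ℝ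
  thetaA : ℝ
  thetaD : ℝ
  /-- noise power of the mmWave tier -/
  noiseT : ℝ
  /-- target SINR -/
  nuT : ℝ
  /-- LoS probability of an aerial base station as a function of its horizontal distance -/
  pLoS : ℝ → ℝ
  lamT_pos : 0 < lamT
  lamA_pos : 0 < lamA
  RB_pos : 0 < RB
  h_pos : 0 < h
  PT_pos : 0 < PT
  PA_pos : 0 < PA
  an_pos : 0 < an
  CT_pos : 0 < CT
  CL_pos : 0 < CL
  CN_pos : 0 < CN
  alphaT_pos : 0 < alphaT
  alphaL_pos : 0 < alphaL
  alphaN_pos : 0 < alphaN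
  mT_pos : 0 < mT
  GM_pos : 0 < GM
  Gm_nonneg : 0 ≤ Gm
  thetaA_pos : 0 < thetaA
  thetaA_le : thetaA ≤ 2 * Real.pi
  thetaD_pos : 0 < thetaD
  thetaD_le : thetaD ≤ Real.pi
  noiseT_pos : 0 < noiseT
  nuT_pos : 0 < nuT
  measurable_pLoS : Measurable pLoS
  pLoS_nonneg : ∀ x, 0 ≤ pLoS x
  pLoS_le_one : ∀ x, pLoS x ≤ 1

namespace Params

variable (P : Params)

/-- Probability that an interferer is received through its main lobe. -/
def pM : ℝ := P.thetaA / (2 * Real.pi) * (P.thetaD / Real.pi)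

/-- Law of the beamforming gain of an interferer. -/
def gainLaw : Measure ℝ :=
  ENNReal.ofReal P.pM • Measure.dirac P.GM + ENNReal.ofReal (1 - P.pM) • Measure.dirac P.Gm

/-- Law of the mmWave channel gains: Gamma with shape `m_T` and scale `1 / m_T` (rate `m_T`). -/
def fadingLaw : Measure ℝ := gammaMeasure P.mT P.mT

/-- Intensity measure of the terrestrial base stations. -/
def intensityT : Measure Plane := ENNReal.ofReal P.lamT • volume

/-- Intensity measure of the LoS aerial base stations. -/
def intensityL : Measure Plane :=
  volume.withDensity fun x => ENNReal.ofReal (P.lamA * P.pLoS ‖x‖)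

/-- Intensity measure of the NLoS aerial base stations. -/
def intensityN : Measure Plane :=
  volume.withDensity fun x => ENNReal.ofReal (P.lamA * (1 - P.pLoS ‖x‖))

/-- Average power received from a terrestrial base station at distance `r ≤ R_B`. -/
def powerT (r : ℝ) : ℝ := P.GM * P.PT * P.CT * r ^ (-P.alphaT)

/-- Average power received from a LoS aerial base station with horizontal location `x`. -/
def powerL (x : Plane) : ℝ :=
  P.an * P.PA * P.CL * (Real.sqrt (‖x‖ ^ 2 + P.h ^ 2)) ^ (-P.alphaL)

/-- Average power received from an NLoS aerial base station with horizontal location `x`. -/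
def powerN (x : Plane) : ℝ :=
  P.an * P.PA * P.CN * (Real.sqrt (‖x‖ ^ 2 + P.h ^ 2)) ^ (-P.alphaN)

/-- `ε_T = ν_T / (G_M P_T C_T)`. -/
def epsT : ℝ := P.nuT / (P.GM * P.PT * P.CT)

/-- `b_T = m_T (m_T !) ^ (-1 / m_T)`. -/
def bT : ℝ := P.mT * (P.mT.factorial : ℝ) ^ (-(1 : ℝ) / P.mT)

end Params

/-! ### The random network -/

/-- A realization of the model on the probability space `(Ω, μ)`. The terrestrial base stations
are numbered by increasing distance from the typical user, so that number `0` is the nearest one. -/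
structure Network (P : Params) {Ω : Type*} [MeasurableSpace Ω] (μ : Measure Ω) where
  /-- location of the `i`-th nearest terrestrial base station -/
  X : ℕ → Ω → Plane
  /-- channel gain between the typical user and the `i`-th terrestrial base station -/
  H : ℕ → Ω → ℝ
  /-- beamforming gain of the `i`-th terrestrial base station as an interferer
  (`G 0` is never used: the serving station has gain `G_M`) -/
  G : ℕ → Ω → ℝ
  /-- horizontal locations of the LoS aerial base stations -/
  PhiL : Ω → Set Plane
  /-- horizontal locations of the NLoS aerial base stations -/
  PhiN : Ω → Set Plane
  measurable_X : ∀ i, Measurable (X i)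
  measurable_H : ∀ i, Measurable (H i)
  measurable_G : ∀ i, Measurable (G i)
  strictMono_norm_X : ∀ᵐ ω ∂μ, StrictMono fun i => ‖X i ω‖
  poisson_T : IsPoissonProcess μ (fun ω => Set.range fun i => X i ω) P.intensityT
  poisson_L : IsPoissonProcess μ PhiL P.intensityL
  poisson_N : IsPoissonProcess μ PhiN P.intensityN
  law_H : ∀ i, μ.map (H i) = P.fadingLaw
  law_G : ∀ i, μ.map (G i) = P.gainLaw
  indep_H : iIndepFun H μ
  indep_G : iIndepFun G μ
  /-- locations, channel gains, beamforming gains and the two aerial processes are independent -/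
  indep_all : iIndep
    ![MeasurableSpace.comap (fun ω i => X i ω) inferInstance,
      MeasurableSpace.comap (fun ω i => H i ω) inferInstance,
      MeasurableSpace.comap (fun ω i => G i ω) inferInstance,
      pointSigma PhiL, pointSigma PhiN] μ

namespace Network

variable {P : Params} {Ω : Type*} [MeasurableSpace Ω] {μ : Measure Ω} (N : Network P μ)

/-- `R_{T,0}`: distance from the typical user to the nearest terrestrial base station. -/
def R (ω : Ω) : ℝ := ‖N.X 0 ω‖

/-- `I_T`: interference from the other terrestrial base stations in the LoS ball. -/
def I (ω : Ω) : ℝ :=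
  ∑' i : ℕ, if ‖N.X (i + 1) ω‖ ≤ P.RB then
    N.G (i + 1) ω * P.PT * P.CT * ‖N.X (i + 1) ω‖ ^ (-P.alphaT) * N.H (i + 1) ω else 0

/-- The typical user is associated with a terrestrial base station: the nearest one lies in the LoS
ball and its average received power exceeds that of every aerial base station. -/
def assocT : Set Ω :=
  {ω | N.R ω ≤ P.RB ∧ (∀ x ∈ N.PhiL ω, P.powerL x < P.powerT (N.R ω)) ∧
    ∀ x ∈ N.PhiN ω, P.powerN x < P.powerT (N.R ω)}

/-- The SINR of the typical user when it is served by the nearest terrestrial base station. -/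
def sinrT (ω : Ω) : ℝ :=
  P.GM * P.PT * P.CT * N.R ω ^ (-P.alphaT) * N.H 0 ω / (N.I ω + P.noiseT)

/-- `P_T^C`: coverage probability of the mmWave tier, given association with that tier. -/
def coverageT : ℝ := (cond μ N.assocT).real {ω | P.nuT ≤ N.sinrT ω}

/-- The probability density of the serving distance, i.e. of `R_{T,0}` given association with a
terrestrial base station. -/
def servingPDF (r : ℝ) : ℝ := (pdf N.R (cond μ N.assocT) volume r).toReal

/-- Laplace transform at `s` of the interference `I_T`, given `R_{T,0} = r`. -/
def laplaceI [IsFiniteMeasure μ] (r s : ℝ) : ℝ :=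
  ∫ y, Real.exp (-s * y) ∂(condDistrib N.I N.R μ r)

/-- Integrand (without the density) of the exact expression of the coverage probability. -/
def exactTerm [IsFiniteMeasure μ] (r : ℝ) : ℝ :=
  ∑ k ∈ Finset.range P.mT, ∑ p ∈ Finset.range (k + 1),
    (k.choose p : ℝ) * (r ^ (P.alphaT * k) * (P.mT * P.epsT) ^ k / (k.factorial : ℝ)) *
      P.noiseT ^ p * Real.exp (-(P.mT * r ^ P.alphaT * P.epsT * P.noiseT)) *
      ((-1) ^ (k - p) * iteratedDeriv (k - p) (N.laplaceI r) (P.mT * P.epsT * r ^ P.alphaT))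

/-- The alternating sum of values of the Laplace transform, with exponential rate `b`. -/
def altTerm [IsFiniteMeasure μ] (b r : ℝ) : ℝ :=
  ∑ k ∈ Finset.Icc 1 P.mT, (-1) ^ (k + 1) * (P.mT.choose k : ℝ) *
    Real.exp (-(k * b * r ^ P.alphaT * P.epsT * P.noiseT)) *
    N.laplaceI r (k * b * r ^ P.alphaT * P.epsT)

/-- The coverage probability with the Gamma distribution function
`ℙ (H_{T,0} < τ)` replaced by `(1 - exp (-b τ)) ^ m_T`. -/
def replacedCoverageT (b : ℝ) : ℝ :=
  ∫ ω, (1 - (1 - Real.exp (-b * (N.R ω ^ P.alphaT * P.epsT * (N.I ω + P.noiseT)))) ^ P.mT)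
    ∂(cond μ N.assocT)

end Network

end

end MmWave

/-! ### Erlang tails and Alzer's inequality -/

section Erlang

open Filter Topology Set

/-! The coverage event is a threshold event for the serving gain. Almost surely the SINR is at least
`ν_T` exactly when `H 0 ≥ τ`, where `τ = R ^ α_T * ε_T * (I + σ²)`. Since `H 0` is independent of
the serving distance, the interference and the aerial processes jointly, it can be integrated out:
the coverage probability is the conditional mean, given association, of the Gamma tail `erlangTail m
(m τ)` (`coverageT_eq`).

Association is decided by `R` and by the aerial processes, and the latter are independent of `(R,
I)`. Conditioning on it therefore changes the law of `R` but not the law of `I` given `R`. So for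
every measurable `Q` bounded by one on `[0, ∞)`, the conditional mean of `Q τ` is obtained by
averaging over `condDistrib I R`, then over the serving density (`intervalIntegral_mul_servingPDF`).
Everything else is a choice of `Q`.

With `Q` the Gamma tail, which for integer shape is a polynomial times an exponential, the binomial
theorem produces moments `y ^ j * exp (-s y)`, that is, signed derivatives of the Laplace transform:
the exact formula. With `Q τ = 1 - (1 - exp (-b τ)) ^ m`, it produces the alternating sum. The two
bounds follow from Alzer's pointwise inequalities between these tails. In each of these the
difference of the two sides is nonnegative at `0`, tends to `0` at infinity, and has a derivative
that cannot become positive again once negative.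

The Poisson hypotheses enter only through void probabilities and local finiteness: these give the
density of `R`, the positive probability of association, and a measurable version of the association
event. -/

/-- The tail `ℙ (X ≥ x)` of a Gamma variable `X` with integer shape `m` and rate `1`. -/
noncomputable def erlangTail (m : ℕ) (x : ℝ) : ℝ :=
  Real.exp (-x) * ∑ k ∈ Finset.range m, x ^ k / (k.factorial : ℝ)

/-- The derivatives of successive terms telescope, leaving only the top one: minus the Gamma
density. -/
lemma hasDerivAt_erlangTail_succ (n : ℕ) (x : ℝ) :
    HasDerivAt (erlangTail (n + 1)) (-(Real.exp (-x) * (x ^ n / (n.factorial : ℝ)))) x := by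
  have hE : HasDerivAt (fun y : ℝ => Real.exp (-y)) (-Real.exp (-x)) x := by
    simpa using (hasDerivAt_neg x).exp
  induction n with
  | zero =>
    have : erlangTail (0 + 1) = fun y => Real.exp (-y) := by
      funext y; simp [erlangTail]
    rw [this]
    simpa using hE
  | succ n ih =>
    have : erlangTail (n + 1 + 1) = fun y => erlangTail (n + 1) y +
        Real.exp (-y) * (y ^ (n + 1) / ((n + 1).factorial : ℝ)) := by
      funext y
      simp only [erlangTail]
      rw [Finset.sum_range_succ _ (n + 1), mul_add]
    rw [this]
    have h2 := ih.add (hE.mul ((hasDerivAt_pow (n + 1) x).div_const ((n + 1).factorial : ℝ)))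
    refine h2.congr_deriv ?_
    have : ((n + 1).factorial : ℝ) = (n + 1) * n.factorial := by
      rw [Nat.factorial_succ]; push_cast; ring
    have h0 : (n.factorial : ℝ) ≠ 0 := by positivity
    rw [this]
    push_cast
    field_simp
    simp

lemma continuous_erlangTail (m : ℕ) : Continuous (erlangTail m) := by
  unfold erlangTail
  fun_prop

lemma tendsto_erlangTail_atTop (m : ℕ) : Tendsto (erlangTail m) atTop (𝓝 0) := by
  have h : ∀ k ∈ Finset.range m,
      Tendsto (fun x : ℝ => x ^ k * Real.exp (-x) / (k.factorial : ℝ)) atTop (𝓝 0) := by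
    intro k _
    simpa using (Real.tendsto_pow_mul_exp_neg_atTop_nhds_zero k).div_const (k.factorial : ℝ)
  have h2 := tendsto_finsetSum _ h
  simp only [Finset.sum_const_zero] at h2
  refine h2.congr fun x => ?_
  rw [erlangTail, Finset.mul_sum]
  exact Finset.sum_congr rfl fun k _ => by ring

lemma erlangTail_nonneg (m : ℕ) {x : ℝ} (hx : 0 ≤ x) : 0 ≤ erlangTail m x :=
  mul_nonneg (Real.exp_pos _).le (Finset.sum_nonneg fun k _ => by positivity)

lemma erlangTail_le_one (m : ℕ) {x : ℝ} (hx : 0 ≤ x) : erlangTail m x ≤ 1 := by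
  rw [erlangTail, Real.exp_neg, inv_mul_le_iff₀ (Real.exp_pos _), mul_one]
  exact Real.sum_le_exp_of_nonneg hx m

lemma erlangTail_zero_right (n : ℕ) : erlangTail (n + 1) 0 = 1 := by
  simp [erlangTail, Finset.sum_range_succ']

/-- The tail of a Gamma law with integer shape. -/
lemma gammaMeasure_Ici (n : ℕ) {r τ : ℝ} (hr : 0 < r) (hτ : 0 ≤ τ) :
    gammaMeasure ((n + 1 : ℕ) : ℝ) r (Ici τ) = ENNReal.ofReal (erlangTail (n + 1) (r * τ)) := by
  have ha : (0 : ℝ) < ((n + 1 : ℕ) : ℝ) := by positivity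
  have hd : ∀ x ∈ Ici τ, HasDerivAt (fun y => -erlangTail (n + 1) (r * y))
      (gammaPDFReal ((n + 1 : ℕ) : ℝ) r x) x := by
    intro x hx
    have hx0 : 0 ≤ x := hτ.trans hx
    have h1 := ((hasDerivAt_erlangTail_succ n (r * x)).comp x
      ((hasDerivAt_id x).const_mul r)).neg
    refine h1.congr_deriv ?_
    rw [gammaPDFReal, if_pos hx0]
    have e1 : Real.Gamma ((n + 1 : ℕ) : ℝ) = n.factorial := by
      push_cast; exact Real.Gamma_nat_eq_factorial n
    have e2 : ((n + 1 : ℕ) : ℝ) - 1 = (n : ℕ) := by push_cast; ring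
    rw [e1, e2, Real.rpow_natCast, Real.rpow_natCast]
    ring
  have ht : Tendsto (fun y => -erlangTail (n + 1) (r * y)) atTop (𝓝 0) := by
    simpa using ((tendsto_erlangTail_atTop (n + 1)).comp
      (tendsto_id.const_mul_atTop hr)).neg
  have hint := integral_Ioi_of_hasDerivAt_of_nonneg'
    hd (fun x _ => gammaPDFReal_nonneg ha hr x) ht
  have hI := integrableOn_Ioi_deriv_of_nonneg'
    hd (fun x _ => gammaPDFReal_nonneg ha hr x) ht
  rw [gammaMeasure, withDensity_apply _ measurableSet_Ici,
    setLIntegral_congr Ioi_ae_eq_Ici.symm]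
  simp only [gammaPDF]
  rw [← ofReal_integral_eq_lintegral_ofReal hI
    (ae_of_all _ fun x => gammaPDFReal_nonneg ha hr x), hint]
  simp

/-- A function that starts nonnegative, tends to `0`, and whose derivative stays nonpositive once
it has been negative, is nonnegative. -/
lemma nonneg_of_single_crossing {g g' : ℝ → ℝ} (hg : ∀ x, HasDerivAt g (g' x) x)
    (h0 : 0 ≤ g 0) (hlim : Tendsto g atTop (𝓝 0))
    (hcross : ∀ x y, 0 < x → x < y → g' x < 0 → g' y ≤ 0) {x : ℝ} (hx : 0 ≤ x) : 0 ≤ g x := by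
  by_contra! hneg
  have hx' : 0 < x := by
    rcases hx.eq_or_lt with h | h
    · subst h; linarith
    · exact h
  have hcont : Continuous g := continuous_iff_continuousAt.2 fun x => (hg x).continuousAt
  -- Falling from `g 0 ≥ 0` to `g x < 0` forces a negative slope somewhere. From there on `g`
  -- decreases, so its limit is at most `g x < 0`, not `0`.
  obtain ⟨ξ, hξ, hξ'⟩ := exists_hasDerivAt_eq_slope g g' hx' hcont.continuousOn
    (fun y _ => hg y)
  have hξneg : g' ξ < 0 := by
    rw [hξ']
    apply div_neg_of_neg_of_pos <;> linarith
  have hanti : AntitoneOn g (Ici ξ) := by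
    apply antitoneOn_of_deriv_nonpos (convex_Ici ξ) hcont.continuousOn
      (fun y _ => (hg y).differentiableAt.differentiableWithinAt)
    intro y hy
    rw [interior_Ici] at hy
    rw [(hg y).deriv]
    exact hcross ξ y hξ.1 hy hξneg
  have : (0 : ℝ) ≤ g x := by
    by_contra
    have hle : ∀ᶠ y in atTop, g y ≤ g x := by
      filter_upwards [eventually_ge_atTop x] with y hy
      exact hanti hξ.2.le (hξ.2.le.trans hy) hy
    linarith [le_of_tendsto hlim hle]
  linarith

/-- This says that `(1 - exp (-u)) / u` decreases: by convexity, `exp` at `-x` lies below its chord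
over `[-y, 0]`. -/
lemma one_sub_exp_neg_mul_le {x y : ℝ} (hx : 0 < x) (hxy : x < y) :
    (1 - Real.exp (-y)) * x ≤ (1 - Real.exp (-x)) * y := by
  have hy : 0 < y := hx.trans hxy
  have h := convexOn_exp.2 (mem_univ (-y)) (mem_univ 0)
    (show 0 ≤ x / y by positivity)
    (show 0 ≤ 1 - x / y by rw [sub_nonneg, div_le_one hy]; exact hxy.le) (by ring)
  have e : (x / y) • (-y) + (1 - x / y) • (0 : ℝ) = -x := by
    simp only [smul_eq_mul]; field_simp; ring
  rw [e] at h
  simp only [smul_eq_mul, Real.exp_zero] at h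
  have h2 := mul_le_mul_of_nonneg_right h hy.le
  have e2 : (x / y * Real.exp (-y) + (1 - x / y) * 1) * y = x * Real.exp (-y) + (y - x) := by
    field_simp
  rw [e2] at h2
  linarith

lemma hasDerivAt_one_sub_exp_neg_pow (s : ℝ) (n : ℕ) (x : ℝ) :
    HasDerivAt (fun y : ℝ => (1 - Real.exp (-(s * y))) ^ (n + 1))
      ((n + 1) * (1 - Real.exp (-(s * x))) ^ n * (s * Real.exp (-(s * x)))) x := by
  have h1 : HasDerivAt (fun y : ℝ => -(s * y)) (-s) x := by
    exact ((hasDerivAt_id x).const_mul s).neg.congr_deriv (by simp)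
  have h := ((h1.exp).const_sub 1).pow (n + 1)
  refine h.congr_deriv ?_
  push_cast
  ring

lemma tendsto_one_sub_exp_neg_pow {s : ℝ} (hs : 0 < s) (n : ℕ) :
    Tendsto (fun y : ℝ => (1 - Real.exp (-(s * y))) ^ n) atTop (𝓝 1) := by
  have h1 : Tendsto (fun y : ℝ => Real.exp (-(s * y))) atTop (𝓝 0) :=
    Real.tendsto_exp_neg_atTop_nhds_zero.comp (tendsto_id.const_mul_atTop hs)
  simpa using (h1.const_sub 1).pow n

/-- The upper half of Alzer's inequality for the Gamma distribution function. -/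
theorem one_sub_one_sub_exp_pow_le_erlangTail {m : ℕ} (hm : 0 < m) {x : ℝ} (hx : 0 ≤ x) :
    1 - (1 - Real.exp (-x)) ^ m ≤ erlangTail m x := by
  obtain ⟨n, rfl⟩ : ∃ n, m = n + 1 := ⟨m - 1, by omega⟩
  have key := nonneg_of_single_crossing
    (g := fun x => (1 - Real.exp (-(1 * x))) ^ (n + 1) - 1 + erlangTail (n + 1) x)
    (fun x => ((hasDerivAt_one_sub_exp_neg_pow 1 n x).sub_const 1).add
      (hasDerivAt_erlangTail_succ n x))
    (by simp [erlangTail_zero_right])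
    (by simpa using ((tendsto_one_sub_exp_neg_pow one_pos (n + 1)).sub_const 1).add
          (tendsto_erlangTail_atTop (n + 1)))
    ?_ hx
  · simp only [one_mul] at key
    linarith
  · intro x y hx hxy h
    simp only [one_mul] at h ⊢
    have hy := hx.trans hxy
    have hf : (0 : ℝ) < n.factorial := by positivity
    -- Up to a positive factor the derivative is `(n + 1)! * ((1 - exp (-x)) / x) ^ n - 1`, and the
    -- ratio inside decreases in `x`.
    have h1 : (n + 1) * n.factorial * (1 - Real.exp (-x)) ^ n < x ^ n := by
      have : Real.exp (-x) * ((n + 1) * n.factorial * (1 - Real.exp (-x)) ^ n)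
          < Real.exp (-x) * x ^ n := by
        have := mul_lt_mul_of_pos_right h hf
        have e : (((n : ℝ) + 1) * (1 - Real.exp (-x)) ^ n * Real.exp (-x) +
          -(Real.exp (-x) * (x ^ n / n.factorial))) * n.factorial =
          Real.exp (-x) * ((n + 1) * n.factorial * (1 - Real.exp (-x)) ^ n)
          - Real.exp (-x) * x ^ n := by field_simp; ring
        rw [e] at this
        linarith
      exact lt_of_mul_lt_mul_left this (Real.exp_pos _).le
    have hy1 : 0 ≤ 1 - Real.exp (-y) := by
      rw [sub_nonneg, Real.exp_le_one_iff]; linarith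
    have h2 := pow_le_pow_left₀ (mul_nonneg hy1 hx.le) (one_sub_exp_neg_mul_le hx hxy) n
    rw [mul_pow, mul_pow] at h2
    have h3 : ((n + 1) * n.factorial * (1 - Real.exp (-y)) ^ n) * x ^ n ≤ y ^ n * x ^ n := by
      have a1 := mul_le_mul_of_nonneg_left h2 (by positivity : (0 : ℝ) ≤ (n + 1) * n.factorial)
      have a2 := mul_le_mul_of_nonneg_right h1.le (by positivity : (0 : ℝ) ≤ y ^ n)
      nlinarith
    have h4 := le_of_mul_le_mul_right h3 (by positivity)
    have e : ((n : ℝ) + 1) * (1 - Real.exp (-y)) ^ n * Real.exp (-y) +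
          -(Real.exp (-y) * (y ^ n / n.factorial)) =
        Real.exp (-y) * ((n + 1) * n.factorial * (1 - Real.exp (-y)) ^ n - y ^ n)
          / n.factorial := by
      field_simp; ring
    rw [e]
    apply div_nonpos_of_nonpos_of_nonneg _ hf.le
    exact mul_nonpos_of_nonneg_of_nonpos (Real.exp_pos _).le (by linarith)

/-- The square root of this inequality is `u / 2 ≤ sinh (u / 2)`. It gives the sign of the second
derivative in the next lemma. -/
lemma sq_mul_exp_le_sq_exp_sub_one {u : ℝ} (hu : 0 < u) :
    u ^ 2 * Real.exp u ≤ (Real.exp u - 1) ^ 2 := by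
  have h := Real.self_le_sinh_iff.2 (by positivity : 0 ≤ u / 2)
  rw [Real.sinh_eq] at h
  have e1 : Real.exp u = Real.exp (u / 2) ^ 2 := by rw [← Real.exp_nat_mul]; congr 1; push_cast; ring
  have e2 : Real.exp (u / 2) * Real.exp (-(u / 2)) = 1 := by rw [← Real.exp_add]; simp
  have h2 : u * Real.exp (u / 2) ≤ Real.exp u - 1 := by
    rw [e1]
    nlinarith [Real.exp_pos (u / 2)]
  calc u ^ 2 * Real.exp u = (u * Real.exp (u / 2)) ^ 2 := by rw [e1]; ring
    _ ≤ _ := pow_le_pow_left₀ (by positivity) h2 2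

lemma concaveOn_log_sub_log_one_sub_exp_neg :
    ConcaveOn ℝ (Ioi 0) fun u : ℝ => Real.log u - Real.log (1 - Real.exp (-u)) := by
  have hpos : ∀ u : ℝ, 0 < u → 0 < Real.exp u - 1 := fun u hu => by
    rw [sub_pos]; exact Real.one_lt_exp_iff.2 hu
  have hpos' : ∀ u : ℝ, 0 < u → 0 < 1 - Real.exp (-u) := fun u hu => by
    rw [sub_pos, Real.exp_lt_one_iff]; linarith
  have h1 : ∀ u : ℝ, 0 < u → HasDerivAt
      (fun u : ℝ => Real.log u - Real.log (1 - Real.exp (-u)))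
      (u⁻¹ - (Real.exp u - 1)⁻¹) u := by
    intro u hu
    have ha : HasDerivAt (fun y : ℝ => 1 - Real.exp (-y)) (Real.exp (-u)) u := by
      simpa using ((hasDerivAt_neg u).exp).const_sub 1
    refine ((Real.hasDerivAt_log hu.ne').sub (ha.log (hpos' u hu).ne')).congr_deriv ?_
    have := (hpos u hu).ne'
    have := (hpos' u hu).ne'
    have e2 : Real.exp u * Real.exp (-u) = 1 := by rw [← Real.exp_add]; simp
    congr 1
    rw [div_eq_iff this, inv_mul_eq_div, eq_div_iff (hpos u hu).ne']
    linear_combination e2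
  have h2 : ∀ u : ℝ, 0 < u → HasDerivAt (fun u : ℝ => u⁻¹ - (Real.exp u - 1)⁻¹)
      (-(u ^ 2)⁻¹ - -Real.exp u / (Real.exp u - 1) ^ 2) u := fun u hu =>
    (hasDerivAt_inv hu.ne').sub (((Real.hasDerivAt_exp u).sub_const 1).inv (hpos u hu).ne')
  refine concaveOn_of_hasDerivWithinAt2_nonpos (convex_Ioi 0)
    (f' := fun u => u⁻¹ - (Real.exp u - 1)⁻¹)
    (f'' := fun u => -(u ^ 2)⁻¹ - -Real.exp u / (Real.exp u - 1) ^ 2)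
    (fun u hu => (h1 u hu).continuousAt.continuousWithinAt) ?_ ?_ ?_
  · intro u hu
    rw [interior_Ioi] at hu
    exact (h1 u hu).hasDerivWithinAt
  · intro u hu
    rw [interior_Ioi] at hu
    exact (h2 u hu).hasDerivWithinAt
  · intro u hu
    rw [interior_Ioi] at hu
    have hu' : 0 < u := hu
    have h3 := sq_mul_exp_le_sq_exp_sub_one hu
    have h4 : Real.exp u / (Real.exp u - 1) ^ 2 ≤ (u ^ 2)⁻¹ := by
      rw [div_le_iff₀ (pow_pos (hpos u hu) 2), inv_mul_eq_div, le_div_iff₀ (by positivity)]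
      linarith
    rw [neg_div]
    linarith

/-- The set where `log (u / (1 - e⁻ᵘ))` is below a given line through the origin is up-closed. -/
lemma log_sub_log_one_sub_exp_neg_crossing {c x y : ℝ} (hx : 0 < x) (hxy : x < y)
    (h : Real.log x - Real.log (1 - Real.exp (-x)) < c * x) :
    Real.log y - Real.log (1 - Real.exp (-y)) ≤ c * y := by
  by_contra! hy
  set φ : ℝ → ℝ := fun u => Real.log u - Real.log (1 - Real.exp (-u)) with hφ
  -- Nonnegativity replaces the value of `φ` at the excluded endpoint `0`: near `0` the function `φ
  -- u - c * u` exceeds `-d`, its value at `x`. If it were positive at `y` too, concavity would be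
  -- violated at `x`.
  have hφ0 : ∀ u : ℝ, 0 < u → 0 ≤ φ u := by
    intro u hu
    rw [hφ, sub_nonneg]
    apply Real.log_le_log
    · rw [sub_pos, Real.exp_lt_one_iff]; linarith
    · linarith [Real.add_one_le_exp (-u)]
  have hc : 0 < c := by
    by_contra! hc
    have := hφ0 x hx
    simp only [hφ] at this
    nlinarith
  set d := c * x - φ x with hd
  have hdpos : 0 < d := by rw [hd]; exact sub_pos.2 h
  set ε := min (x / 2) (d / (2 * c)) with hε
  have hεpos : 0 < ε := by positivity
  -- The two terms of the minimum give `ε < x` and `c * ε < d`, which is all the chord argument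
  -- needs.
  have hεx : ε < x := (min_le_left _ _).trans_lt (by linarith)
  have hεd : c * ε < d := by
    have : c * ε ≤ c * (d / (2 * c)) := mul_le_mul_of_nonneg_left (min_le_right _ _) hc.le
    have e : c * (d / (2 * c)) = d / 2 := by field_simp
    linarith
  have hcc := concaveOn_log_sub_log_one_sub_exp_neg.2
    (mem_Ioi.2 hεpos) (mem_Ioi.2 (hx.trans hxy))
    (show 0 ≤ (y - x) / (y - ε) from div_nonneg (by linarith) (by linarith))
    (show 0 ≤ (x - ε) / (y - ε) from div_nonneg (by linarith) (by linarith))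
    (by have : y - ε ≠ 0 := by linarith
        field_simp; ring)
  have hne : y - ε ≠ 0 := by linarith
  have e1 : ((y - x) / (y - ε)) • ε + ((x - ε) / (y - ε)) • y = x := by
    simp only [smul_eq_mul]; field_simp; ring
  rw [e1] at hcc
  simp only [smul_eq_mul] at hcc
  change _ * φ ε + _ * φ y ≤ φ x at hcc
  have ha : 0 ≤ (y - x) / (y - ε) := div_nonneg (by linarith) (by linarith)
  have hb : 0 < (x - ε) / (y - ε) := div_pos (by linarith) (by linarith)
  have hab : (y - x) / (y - ε) + (x - ε) / (y - ε) = 1 := by field_simp; ring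
  have k1 := mul_le_mul_of_nonneg_left (by linarith [hφ0 ε hεpos] : c * ε - d ≤ φ ε) ha
  have k2 := mul_lt_mul_of_pos_left hy hb
  change _ < _ * φ y at k2
  simp only [smul_eq_mul] at e1
  have k3 : (y - x) / (y - ε) * (c * ε - d) + (x - ε) / (y - ε) * (c * y) =
      c * ((y - x) / (y - ε) * ε + (x - ε) / (y - ε) * y) - (y - x) / (y - ε) * d := by ring
  rw [e1] at k3
  have k4 : (y - x) / (y - ε) * d ≤ d := by
    have : (y - x) / (y - ε) ≤ 1 := by linarith
    nlinarith
  linarith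

/-- The lower half of Alzer's inequality for the Gamma distribution function. -/
theorem erlangTail_le_one_sub_one_sub_exp_pow {m : ℕ} (hm : 0 < m) {s : ℝ} (hs : 0 < s)
    (hsm : s ^ m * m.factorial = 1) {x : ℝ} (hx : 0 ≤ x) :
    erlangTail m x ≤ 1 - (1 - Real.exp (-(s * x))) ^ m := by
  obtain ⟨n, rfl⟩ : ∃ n, m = n + 1 := ⟨m - 1, by omega⟩
  have hfac : ((n + 1).factorial : ℝ) = (n + 1) * n.factorial := by
    rw [Nat.factorial_succ]; push_cast; ring
  rw [hfac] at hsm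
  have hf : (0 : ℝ) < n.factorial := by positivity
  have hpos : ∀ u : ℝ, 0 < u → 0 < 1 - Real.exp (-u) := fun u hu => by
    rw [sub_pos, Real.exp_lt_one_iff]; linarith
  -- The normalization of `s` matches the leading terms of the two distribution functions at `0`;
  -- here it turns `x ^ n / n!` into `(n + 1) * s * (s * x) ^ n`.
  have hderiv : ∀ x : ℝ, -(((n : ℝ) + 1) * (1 - Real.exp (-(s * x))) ^ n
        * (s * Real.exp (-(s * x)))) - -(Real.exp (-x) * (x ^ n / n.factorial)) =
      (n + 1) * s * ((s * x) ^ n * Real.exp (-x)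
        - (1 - Real.exp (-(s * x))) ^ n * Real.exp (-(s * x))) := by
    intro x
    have : x ^ n / n.factorial = (n + 1) * s * (s * x) ^ n := by
      rw [div_eq_iff hf.ne', mul_pow]
      linear_combination (-x ^ n) * hsm
    rw [this]
    ring
  -- Taking logarithms, the derivative is negative exactly where `log (u / (1 - exp (-u)))`, at `u =
  -- s * x`, lies below a line through the origin.
  have hsign : ∀ x : ℝ, 0 < x → ((s * x) ^ n * Real.exp (-x)
        < (1 - Real.exp (-(s * x))) ^ n * Real.exp (-(s * x)) ↔
      n * (Real.log (s * x) - Real.log (1 - Real.exp (-(s * x)))) < (s⁻¹ - 1) * (s * x)) := by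
    intro x hx
    have hsx : 0 < s * x := by positivity
    have hp := hpos _ hsx
    rw [← Real.log_lt_log_iff (by positivity) (by positivity), Real.log_mul (by positivity)
      (by positivity), Real.log_mul (by positivity) (by positivity), Real.log_pow, Real.log_pow,
      Real.log_exp, Real.log_exp]
    have : (s⁻¹ - 1) * (s * x) = x - s * x := by field_simp
    rw [this]
    constructor <;> intro h <;> linarith
  have key := nonneg_of_single_crossing
    (g := fun x => 1 - (1 - Real.exp (-(s * x))) ^ (n + 1) - erlangTail (n + 1) x)
    (fun x => ((hasDerivAt_one_sub_exp_neg_pow s n x).const_sub 1).sub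
      (hasDerivAt_erlangTail_succ n x))
    (by simp [erlangTail_zero_right])
    (by simpa using ((tendsto_one_sub_exp_neg_pow hs (n + 1)).const_sub 1).sub
          (tendsto_erlangTail_atTop (n + 1)))
    ?_ hx
  · linarith
  · intro x y hx hxy h
    rw [hderiv] at h ⊢
    have hns : 0 < ((n : ℝ) + 1) * s := by positivity
    have h1 : (s * x) ^ n * Real.exp (-x)
        < (1 - Real.exp (-(s * x))) ^ n * Real.exp (-(s * x)) := by
      by_contra! h1
      have := mul_nonneg hns.le (sub_nonneg.2 h1)
      linarith
    rw [hsign x hx] at h1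
    apply mul_nonpos_of_nonneg_of_nonpos hns.le
    rw [sub_nonpos]
    -- The slope of that line is `(s⁻¹ - 1) / n`, so `n = 0` is separate; there `s = 1` and the
    -- derivative vanishes.
    rcases Nat.eq_zero_or_pos n with hn | hn
    · subst hn
      have : s = 1 := by simpa using hsm
      subst this
      simp
    · have hn' : (0 : ℝ) < n := by exact_mod_cast hn
      have h2 : Real.log (s * x) - Real.log (1 - Real.exp (-(s * x)))
          < (s⁻¹ - 1) / n * (s * x) := by
        rw [div_mul_eq_mul_div, lt_div_iff₀ hn']
        linarith
      have h3 := log_sub_log_one_sub_exp_neg_crossing (by positivity)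
        (mul_lt_mul_of_pos_left hxy hs) h2
      rw [div_mul_eq_mul_div, le_div_iff₀ hn'] at h3
      have hsy : 0 < s * y := mul_pos hs (hx.trans hxy)
      have hp := hpos _ hsy
      rw [← Real.log_le_log_iff (by positivity) (by positivity), Real.log_mul (by positivity)
        (by positivity), Real.log_mul (by positivity) (by positivity), Real.log_pow, Real.log_pow,
        Real.log_exp, Real.log_exp]
      have : (s⁻¹ - 1) * (s * y) = y - s * y := by field_simp
      rw [this] at h3
      linarith

end Erlang

/-! ### Radial null sets and Poisson processes -/

section Radial

open Set

/-- In polar coordinates the indicator of the preimage becomes a radial integral that does not see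
the null set `S`. Working with integrals of functions avoids assuming `S` measurable. -/
lemma addHaar_norm_preimage_eq_zero {E : Type*} [NormedAddCommGroup E] [NormedSpace ℝ E]
    [FiniteDimensional ℝ E] [Nontrivial E] [MeasurableSpace E] [BorelSpace E] (ν : Measure E)
    [ν.IsAddHaarMeasure] {S : Set ℝ} (h0 : volume S = 0) :
    ν {x : E | ‖x‖ ∈ S} = 0 := by
  have hae : (fun y : ℝ => y ^ (Module.finrank ℝ E - 1) • S.indicator (fun _ => (1 : ℝ)) y)
      =ᵐ[volume.restrict (Ioi 0)] 0 := by
    have : ∀ᵐ y : ℝ, y ∉ S := measure_eq_zero_iff_ae_notMem.1 h0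
    filter_upwards [ae_restrict_of_ae this] with y hy
    simp [hy]
  have hint : Integrable (fun x : E => S.indicator (fun _ => (1 : ℝ)) ‖x‖) ν :=
    (integrable_fun_norm_addHaar ν).2 ((integrable_zero _ _ _).congr hae.symm)
  have hzero := integral_fun_norm_addHaar ν (S.indicator fun _ => (1 : ℝ))
  rw [integral_congr_ae hae] at hzero
  simp only [Pi.zero_apply, integral_zero, smul_zero] at hzero
  rw [integral_eq_zero_iff_of_nonneg
    (fun x => indicator_nonneg (fun _ _ => zero_le_one) _) hint] at hzero
  rw [measure_eq_zero_iff_ae_notMem]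
  filter_upwards [hzero] with x hx hxS
  have hxS' : ‖x‖ ∈ S := hxS
  simp [hxS'] at hx

end Radial

namespace MmWave

open Set

/-! ### Void probabilities and local finiteness of Poisson processes -/

section Poisson

variable {Ω E : Type*} [MeasurableSpace Ω] [MeasurableSpace E] {μ : Measure Ω}
  {Φ : Ω → Set E} {Λ : Measure E}

lemma IsPoissonProcess.measure_count_eq_zero (h : IsPoissonProcess μ Φ Λ) {B : Set E}
    (hB : MeasurableSet B) (hΛ : Λ B ≠ ⊤) :
    μ {ω | pointCount Φ B ω = 0} = ENNReal.ofReal (Real.exp (-(Λ B).toReal)) := by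
  have h1 : μ {ω | pointCount Φ B ω = 0} = μ.map (pointCount Φ B) {0} :=
    (Measure.map_apply (h.measurable_count B hB) (measurableSet_singleton _)).symm
  have hm : Measurable fun n : ℕ => (n : ℕ∞) := measurable_from_nat
  rw [h1, h.law_count B hB hΛ, Measure.map_apply hm (measurableSet_singleton _)]
  have : (fun n : ℕ => (n : ℕ∞)) ⁻¹' {0} = {0} := by ext n; simp
  rw [this, poissonMeasure_singleton]
  simp [ENNReal.coe_toNNReal_eq_toReal]

lemma IsPoissonProcess.ae_finite_inter (h : IsPoissonProcess μ Φ Λ) {B : Set E}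
    (hB : MeasurableSet B) (hΛ : Λ B ≠ ⊤) : ∀ᵐ ω ∂μ, (Φ ω ∩ B).Finite := by
  have hm : Measurable fun n : ℕ => (n : ℕ∞) := measurable_from_nat
  have h1 : μ.map (pointCount Φ B) {⊤} = 0 := by
    rw [h.law_count B hB hΛ, Measure.map_apply hm (measurableSet_singleton _)]
    have : (fun n : ℕ => (n : ℕ∞)) ⁻¹' {⊤} = ∅ := by ext n; simp
    rw [this, measure_empty]
  rw [Measure.map_apply (h.measurable_count B hB) (measurableSet_singleton _)] at h1
  filter_upwards [measure_eq_zero_iff_ae_notMem.1 h1] with ω hω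
  exact encard_ne_top_iff.1 hω

lemma IsPoissonProcess.ae_inter_eq_empty [IsProbabilityMeasure μ] (h : IsPoissonProcess μ Φ Λ)
    {B : Set E} (hB : MeasurableSet B) (hΛ : Λ B = 0) : ∀ᵐ ω ∂μ, Φ ω ∩ B = ∅ := by
  have h1 := h.measure_count_eq_zero hB (by simp [hΛ])
  rw [hΛ] at h1
  simp only [ENNReal.toReal_zero, neg_zero, Real.exp_zero, ENNReal.ofReal_one] at h1
  have hmeas : MeasurableSet {ω | pointCount Φ B ω = 0} :=
    h.measurable_count B hB (measurableSet_singleton 0)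
  filter_upwards [(prob_compl_eq_zero_iff hmeas).2 h1 |> measure_eq_zero_iff_ae_notMem.1]
    with ω hω
  simpa [pointCount] using hω

/-- Numbers of points of `Φ` in the superlevel sets of `p` at rational levels. -/
noncomputable def superlevelCount (p : E → ℝ) (Φ : Ω → Set E) (ω : Ω) (q : ℚ) : ℕ∞ :=
  pointCount Φ {x | (q : ℝ) ≤ p x} ω

omit [MeasurableSpace Ω] in
-- Measurability is needed for `pointSigma Φ` itself, since the independence of the model is stated
-- for these σ-algebras.
lemma measurable_superlevelCount {p : E → ℝ} (hp : Measurable p) :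
    Measurable[pointSigma Φ] (superlevelCount p Φ) := by
  refine @measurable_pi_lambda _ _ _ (pointSigma Φ) _ _ fun q => ?_
  have hB : MeasurableSet {x | (q : ℝ) ≤ p x} := measurableSet_le measurable_const hp
  have h1 : MeasurableSpace.comap (pointCount Φ {x | (q : ℝ) ≤ p x}) inferInstance
      ≤ pointSigma Φ :=
    le_iSup (fun B : {B : Set E // MeasurableSet B} =>
      MeasurableSpace.comap (pointCount Φ B.1) inferInstance) ⟨_, hB⟩
  exact Measurable.mono (comap_measurable _) h1 le_rfl

lemma IsPoissonProcess.pointSigma_le (h : IsPoissonProcess μ Φ Λ) :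
    pointSigma Φ ≤ (inferInstance : MeasurableSpace Ω) :=
  iSup_le fun B => (h.measurable_count B.1 B.2).comap_le

/-- All points of a Poisson process are below level `t` as soon as no point lies in some
superlevel set at a rational level below `t`. -/
lemma IsPoissonProcess.ae_forall_lt_iff (h : IsPoissonProcess μ Φ Λ) {p : E → ℝ}
    (hp : Measurable p) (hfin : ∀ q : ℝ, 0 < q → Λ {x | q ≤ p x} ≠ ⊤) :
    ∀ᵐ ω ∂μ, ∀ t : ℝ, 0 < t →
      ((∀ x ∈ Φ ω, p x < t) ↔ ∃ q : ℚ, (q : ℝ) < t ∧ superlevelCount p Φ ω q = 0) := by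
  have hf : ∀ᵐ ω ∂μ, ∀ q : ℚ, 0 < q → (Φ ω ∩ {x | (q : ℝ) ≤ p x}).Finite := by
    rw [ae_all_iff]
    intro q
    by_cases hq : 0 < q
    · filter_upwards [h.ae_finite_inter (measurableSet_le measurable_const hp)
        (hfin q (by exact_mod_cast hq))] with ω hω _
      exact hω
    · exact ae_of_all _ fun ω h => absurd h hq
  filter_upwards [hf] with ω hω t ht
  constructor
  · intro hlt
    -- Above a positive level there are only finitely many points, so the largest value of `p` is
    -- attained and a rational fits between it and `t`.
    obtain ⟨q, hq0, hqt⟩ := exists_rat_btwn ht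
    have hfin := hω q (by exact_mod_cast hq0)
    rcases (Φ ω ∩ {x | (q : ℝ) ≤ p x}).eq_empty_or_nonempty with he | hne
    · exact ⟨q, hqt, by simpa [superlevelCount, pointCount] using he⟩
    · obtain ⟨x, hx, hmax⟩ := exists_max_image _ p hfin hne
      obtain ⟨q', hq', hq't⟩ := exists_rat_btwn (hlt x hx.1)
      refine ⟨q', hq't, ?_⟩
      simp only [superlevelCount, pointCount, encard_eq_zero]
      rw [eq_empty_iff_forall_notMem]
      rintro y ⟨hy, hy'⟩
      have hy'' : (q' : ℝ) ≤ p y := hy'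
      have hqx : (q : ℝ) ≤ p x := hx.2
      have := hmax y ⟨hy, show (q : ℝ) ≤ p y by linarith⟩
      linarith
  · rintro ⟨q, hqt, hq⟩ x hx
    simp only [superlevelCount, pointCount, encard_eq_zero] at hq
    by_contra! hle
    have : x ∈ Φ ω ∩ {x | (q : ℝ) ≤ p x} := ⟨hx, show (q : ℝ) ≤ p x by linarith⟩
    rw [hq] at this
    exact this

end Poisson

end MmWave

/-! ### Independence and conditional distributions -/

section Independence

variable {Ω α β γ δ : Type*} [MeasurableSpace Ω] [MeasurableSpace α] [MeasurableSpace β]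
  [MeasurableSpace γ] [MeasurableSpace δ] {μ : Measure Ω} [IsProbabilityMeasure μ]

/-- The joint law is a threefold product measure, which may be reassociated. -/
lemma ProbabilityTheory.IndepFun.prodMk_right_of_prodMk_left {X : Ω → α} {Y : Ω → β} {Z : Ω → γ}
    (hX : Measurable X) (hY : Measurable Y) (hZ : Measurable Z) (hXY : IndepFun X Y μ)
    (h : IndepFun (fun ω => (X ω, Y ω)) Z μ) : IndepFun X (fun ω => (Y ω, Z ω)) μ := by
  have := Measure.isProbabilityMeasure_map (μ := μ) hX.aemeasurable
  have := Measure.isProbabilityMeasure_map (μ := μ) hY.aemeasurable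
  have := Measure.isProbabilityMeasure_map (μ := μ) hZ.aemeasurable
  have hYZ : IndepFun Y Z μ := h.comp measurable_snd measurable_id
  rw [indepFun_iff_map_prod_eq_prod_map_map hX.aemeasurable (hY.prodMk hZ).aemeasurable]
  rw [indepFun_iff_map_prod_eq_prod_map_map (hX.prodMk hY).aemeasurable hZ.aemeasurable] at h
  rw [indepFun_iff_map_prod_eq_prod_map_map hX.aemeasurable hY.aemeasurable] at hXY
  rw [indepFun_iff_map_prod_eq_prod_map_map hY.aemeasurable hZ.aemeasurable] at hYZ
  rw [hYZ, ← Measure.prodAssoc_prod, ← hXY, ← h,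
    Measure.map_map MeasurableEquiv.prodAssoc.measurable ((hX.prodMk hY).prodMk hZ)]
  rfl

/-- The probability that an independent variable `H` exceeds a random threshold, through the tail
function of `H`. -/
lemma measureReal_threshold_eq_setIntegral {Z : Ω → α} {H : Ω → ℝ} (hZ : Measurable Z)
    (hH : Measurable H) (hind : IndepFun Z H μ) {M : Set α} (hM : MeasurableSet M) {τ : α → ℝ}
    (hτ : Measurable τ) {Q : ℝ → ℝ} (hQ : Measurable Q)
    (htail : ∀ᵐ ω ∂μ, μ.map H (Set.Ici (τ (Z ω))) = ENNReal.ofReal (Q (τ (Z ω))))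
    (hnn : ∀ᵐ ω ∂μ, 0 ≤ Q (τ (Z ω))) :
    μ.real {ω | Z ω ∈ M ∧ τ (Z ω) ≤ H ω} = ∫ ω in Z ⁻¹' M, Q (τ (Z ω)) ∂μ := by
  have := Measure.isProbabilityMeasure_map (μ := μ) hZ.aemeasurable
  have := Measure.isProbabilityMeasure_map (μ := μ) hH.aemeasurable
  have hS : MeasurableSet {p : α × ℝ | p.1 ∈ M ∧ τ p.1 ≤ p.2} :=
    (measurable_fst hM).inter (measurableSet_le (hτ.comp measurable_fst) measurable_snd)
  have hprod := (indepFun_iff_map_prod_eq_prod_map_map hZ.aemeasurable hH.aemeasurable).1 hind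
  have h1 : μ {ω | Z ω ∈ M ∧ τ (Z ω) ≤ H ω} =
      ∫⁻ ω in Z ⁻¹' M, ENNReal.ofReal (Q (τ (Z ω))) ∂μ := by
    calc μ {ω | Z ω ∈ M ∧ τ (Z ω) ≤ H ω}
        = μ.map (fun ω => (Z ω, H ω)) {p : α × ℝ | p.1 ∈ M ∧ τ p.1 ≤ p.2} :=
          (Measure.map_apply (hZ.prodMk hH) hS).symm
      _ = ∫⁻ z, μ.map H (Prod.mk z ⁻¹' {p : α × ℝ | p.1 ∈ M ∧ τ p.1 ≤ p.2}) ∂(μ.map Z) := by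
          rw [hprod, Measure.prod_apply hS]
      _ = ∫⁻ ω, μ.map H (Prod.mk (Z ω) ⁻¹' {p : α × ℝ | p.1 ∈ M ∧ τ p.1 ≤ p.2}) ∂μ :=
          lintegral_map (measurable_measure_prodMk_left hS) hZ
      _ = ∫⁻ ω, (Z ⁻¹' M).indicator (fun ω => ENNReal.ofReal (Q (τ (Z ω)))) ω ∂μ := by
          refine lintegral_congr_ae ?_
          filter_upwards [htail] with ω hω
          by_cases hm : Z ω ∈ M
          · rw [Set.indicator_of_mem (show ω ∈ Z ⁻¹' M from hm), ← hω]
            congr 1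
            ext h
            simp [hm]
          · rw [Set.indicator_of_notMem (show ω ∉ Z ⁻¹' M from hm)]
            have : Prod.mk (Z ω) ⁻¹' {p : α × ℝ | p.1 ∈ M ∧ τ p.1 ≤ p.2} = ∅ := by
              ext h
              simp [hm]
            rw [this, measure_empty]
      _ = _ := lintegral_indicator (hZ hM) _
  rw [integral_eq_lintegral_of_nonneg_ae (ae_restrict_of_ae hnn)
    (hQ.comp (hτ.comp hZ)).aestronglyMeasurable, measureReal_def, h1]

/-- On an event that depends only on `X` and on a variable independent of `(X, Y)`, a function of
`(X, Y)` may be averaged with respect to the conditional law of `Y` given `X`. -/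
lemma setIntegral_eq_setIntegral_integral_kernel {X : Ω → α} {Y : Ω → β} {D : Ω → δ}
    (hX : Measurable X) (hY : Measurable Y) (hD : Measurable D)
    (hind : IndepFun (fun ω => (X ω, Y ω)) D μ) (κ : Kernel α β) [IsMarkovKernel κ]
    (hκ : (μ.map X).compProd κ = μ.map fun ω => (X ω, Y ω))
    {M : Set (α × δ)} (hM : MeasurableSet M) {q : α × β → ℝ} (hq : Measurable q)
    (hint : Integrable (fun ω => q (X ω, Y ω)) μ) :
    ∫ ω in (fun ω => (X ω, D ω)) ⁻¹' M, q (X ω, Y ω) ∂μ =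
      ∫ ω in (fun ω => (X ω, D ω)) ⁻¹' M, (∫ y, q (X ω, y) ∂(κ (X ω))) ∂μ := by
  have := Measure.isProbabilityMeasure_map (μ := μ) hX.aemeasurable
  have := Measure.isProbabilityMeasure_map (μ := μ) hD.aemeasurable
  have := Measure.isProbabilityMeasure_map (μ := μ) (hX.prodMk hY).aemeasurable
  set T : α → ℝ := fun x => ∫ y, q (x, y) ∂(κ x) with hT
  have hTm : StronglyMeasurable T := hq.stronglyMeasurable.integral_kernel_prod_right'
  -- `a x` is the probability that `(x, D)` falls in `M`. Both sides will equal the integral of `a *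
  -- T` against the law of `X`.
  set a : α → ℝ := fun x => ∫ d, M.indicator (fun _ => (1 : ℝ)) (x, d) ∂(μ.map D) with ha
  have hMi : Measurable (M.indicator fun _ => (1 : ℝ)) := measurable_const.indicator hM
  have hqint : Integrable q ((μ.map X).compProd κ) := by
    rw [hκ, integrable_map_measure hq.aestronglyMeasurable (hX.prodMk hY).aemeasurable]
    exact hint
  have hTint : Integrable T (μ.map X) := Integrable.integral_compProd hqint
  have hXD : IndepFun X D μ := hind.comp measurable_fst measurable_id
  have hp1 := (indepFun_iff_map_prod_eq_prod_map_map (hX.prodMk hY).aemeasurable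
    hD.aemeasurable).1 hind
  have hp2 := (indepFun_iff_map_prod_eq_prod_map_map hX.aemeasurable hD.aemeasurable).1 hXD
  have hpre : MeasurableSet ((fun ω => (X ω, D ω)) ⁻¹' M) := (hX.prodMk hD) hM
  have hb : ∀ z, ‖M.indicator (fun _ => (1 : ℝ)) z‖ ≤ 1 := fun z => by
    by_cases hz : z ∈ M <;> simp [hz]
  have e1 : ∫ ω in (fun ω => (X ω, D ω)) ⁻¹' M, q (X ω, Y ω) ∂μ = ∫ x, a x * T x ∂(μ.map X) := by
    set F : (α × β) × δ → ℝ := fun z => M.indicator (fun _ => (1 : ℝ)) (z.1.1, z.2) * q z.1 with hF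
    have hFm : Measurable F :=
      (hMi.comp ((measurable_fst.comp measurable_fst).prodMk measurable_snd)).mul
        (hq.comp measurable_fst)
    have hFi : Integrable F ((μ.map fun ω => (X ω, Y ω)).prod (μ.map D)) := by
      rw [← hp1, integrable_map_measure hFm.aestronglyMeasurable
        ((hX.prodMk hY).prodMk hD).aemeasurable]
      exact hint.bdd_mul (hMi.comp (hX.prodMk hD)).aestronglyMeasurable
        (ae_of_all _ fun ω => hb _)
    calc ∫ ω in (fun ω => (X ω, D ω)) ⁻¹' M, q (X ω, Y ω) ∂μ
        = ∫ ω, F ((X ω, Y ω), D ω) ∂μ := by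
          rw [← integral_indicator hpre]
          refine integral_congr_ae (ae_of_all _ fun ω => ?_)
          by_cases hm : (X ω, D ω) ∈ M <;> simp [F, Set.indicator, hm]
      _ = ∫ z, F z ∂((μ.map fun ω => (X ω, Y ω)).prod (μ.map D)) := by
          rw [← hp1, integral_map ((hX.prodMk hY).prodMk hD).aemeasurable
            hFm.aestronglyMeasurable]
      _ = ∫ z, a z.1 * q z ∂((μ.map X).compProd κ) := by
          rw [integral_prod F hFi, hκ]
          refine integral_congr_ae (ae_of_all _ fun z => ?_)
          simp only [F, ha]
          rw [integral_mul_const]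
      _ = ∫ x, ∫ y, a x * q (x, y) ∂(κ x) ∂(μ.map X) := by
          refine Measure.integral_compProd (f := fun z : α × β => a z.1 * q z) ?_
          have ham : Measurable a :=
            (hMi.stronglyMeasurable.integral_prod_right' (ν := μ.map D)).measurable
          refine hqint.bdd_mul (c := 1) (ham.comp measurable_fst).aestronglyMeasurable
            (ae_of_all _ fun z => ?_)
          simp only [ha]
          refine (norm_integral_le_of_norm_le_const (ae_of_all _ fun d => hb _)).trans ?_
          simp
      _ = ∫ x, a x * T x ∂(μ.map X) := by simp_rw [integral_const_mul, hT]
  have e2 : ∫ ω in (fun ω => (X ω, D ω)) ⁻¹' M, T (X ω) ∂μ = ∫ x, a x * T x ∂(μ.map X) := by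
    set F : α × δ → ℝ := fun z => M.indicator (fun _ => (1 : ℝ)) z * T z.1 with hF
    have hFm : Measurable F := hMi.mul (hTm.measurable.comp measurable_fst)
    have hFi : Integrable F ((μ.map X).prod (μ.map D)) := by
      rw [← hp2, integrable_map_measure hFm.aestronglyMeasurable (hX.prodMk hD).aemeasurable]
      refine Integrable.bdd_mul (c := 1) ?_ (hMi.comp (hX.prodMk hD)).aestronglyMeasurable
        (ae_of_all _ fun ω => hb _)
      exact (integrable_map_measure hTm.aestronglyMeasurable hX.aemeasurable).1 hTint
    calc ∫ ω in (fun ω => (X ω, D ω)) ⁻¹' M, T (X ω) ∂μ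
        = ∫ ω, F (X ω, D ω) ∂μ := by
          rw [← integral_indicator hpre]
          refine integral_congr_ae (ae_of_all _ fun ω => ?_)
          by_cases hm : (X ω, D ω) ∈ M <;> simp [F, Set.indicator, hm]
      _ = ∫ z, F z ∂((μ.map X).prod (μ.map D)) := by
          rw [← hp2, integral_map (hX.prodMk hD).aemeasurable hFm.aestronglyMeasurable]
      _ = ∫ x, a x * T x ∂(μ.map X) := by
          rw [integral_prod F hFi]
          refine integral_congr_ae (ae_of_all _ fun x => ?_)
          simp only [F, ha]
          rw [integral_mul_const]
  rw [e1, e2]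

end Independence

/-! ### Laplace transforms of nonnegative variables -/

section Laplace

open Set

variable {κ : Measure ℝ} [IsProbabilityMeasure κ]

/-- For every `t > 0` the function `exp (-t y)` is bounded on the support of `κ`. Interior points
are where the moment generating function of `-y`, i.e. the Laplace transform, may be differentiated
under the integral. -/
lemma mem_interior_integrableExpSet_neg (hκ : ∀ᵐ y ∂κ, 0 ≤ y) {s : ℝ} (hs : 0 < s) :
    s ∈ interior (integrableExpSet (fun y : ℝ => -y) κ) := by
  refine interior_mono (s := Ioi 0) ?_ (by rwa [interior_Ioi])
  intro t ht
  have ht' : 0 < t := ht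
  refine Integrable.of_bound (C := 1) (by fun_prop) ?_
  filter_upwards [hκ] with y hy
  rw [Real.norm_eq_abs, abs_of_pos (Real.exp_pos _), Real.exp_le_one_iff]
  nlinarith

lemma integrable_pow_mul_exp_neg (hκ : ∀ᵐ y ∂κ, 0 ≤ y) {s : ℝ} (hs : 0 < s) (n : ℕ) :
    Integrable (fun y : ℝ => y ^ n * Real.exp (-s * y)) κ := by
  have h := (integrable_pow_mul_exp_of_mem_interior_integrableExpSet
    (mem_interior_integrableExpSet_neg hκ hs) n).const_mul ((-1) ^ n)
  refine h.congr (ae_of_all _ fun y => ?_)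
  simp only
  rw [← mul_assoc, ← mul_pow]
  congr 2 <;> ring

lemma iteratedDeriv_laplace (hκ : ∀ᵐ y ∂κ, 0 ≤ y) {s : ℝ} (hs : 0 < s) (n : ℕ) :
    (-1) ^ n * iteratedDeriv n (fun t => ∫ y, Real.exp (-t * y) ∂κ) s =
      ∫ y, y ^ n * Real.exp (-s * y) ∂κ := by
  have h1 : (fun t => ∫ y, Real.exp (-t * y) ∂κ) = mgf (fun y : ℝ => -y) κ := by
    funext t
    simp only [mgf]
    congr 1
    funext y
    congr 1
    ring
  rw [h1, iteratedDeriv_mgf (mem_interior_integrableExpSet_neg hκ hs), ← integral_const_mul]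
  congr 1
  funext y
  rw [← mul_assoc, ← mul_pow]
  congr 2 <;> ring

end Laplace

/-! ### Integrals against a probability density -/

section Density

/-- Off the support of the law of `X` the density kills the product, so `f` need only agree with the
measurable `T` almost everywhere for that law. No measurability of `f` is needed, which suits terms
built from iterated derivatives. -/
lemma intervalIntegral_mul_pdf {Ω : Type*} [MeasurableSpace Ω] {ν : Measure Ω}
    [IsProbabilityMeasure ν] {X : Ω → ℝ} (hX : Measurable X) [HasPDF X ν volume] {b : ℝ}
    (hb : 0 ≤ b) (hXb : ∀ᵐ ω ∂ν, X ω ∈ Set.Ioc 0 b) {f T : ℝ → ℝ} (hT : Measurable T)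
    (hfT : f =ᵐ[ν.map X] T) (hint : Integrable (fun ω => T (X ω)) ν) :
    IntervalIntegrable (fun r => f r * (pdf X ν volume r).toReal) volume 0 b ∧
      ∫ r in (0 : ℝ)..b, f r * (pdf X ν volume r).toReal = ∫ ω, T (X ω) ∂ν := by
  have hmap := map_eq_withDensity_pdf X ν volume
  have hae : (fun r => f r * (pdf X ν volume r).toReal) =ᵐ[volume]
      fun r => (pdf X ν volume r).toReal • T r := by
    rw [hmap] at hfT
    have := (ae_withDensity_iff (measurable_pdf X ν volume)).1 hfT
    filter_upwards [this] with r hr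
    by_cases h0 : pdf X ν volume r = 0
    · simp [h0]
    · rw [hr h0, smul_eq_mul, mul_comm]
  have hvan : ∀ᵐ r ∂(volume : Measure ℝ), r ∉ Set.Ioc 0 b →
      f r * (pdf X ν volume r).toReal = 0 := by
    have h1 : ∀ᵐ r ∂(ν.map X), r ∈ Set.Ioc 0 b :=
      (ae_map_iff hX.aemeasurable measurableSet_Ioc).2 hXb
    rw [hmap] at h1
    filter_upwards [(ae_withDensity_iff (measurable_pdf X ν volume)).1 h1] with r hr hnot
    by_cases h0 : pdf X ν volume r = 0
    · simp [h0]
    · exact absurd (hr h0) hnot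
  have hI : Integrable (fun r => f r * (pdf X ν volume r).toReal) volume :=
    ((pdf.integrable_pdf_smul_iff hT.aestronglyMeasurable).2 hint).congr hae.symm
  refine ⟨hI.intervalIntegrable, ?_⟩
  rw [intervalIntegral.integral_of_le hb, setIntegral_eq_integral_of_ae_compl_eq_zero hvan,
    integral_congr_ae hae, pdf.integral_pdf_smul hT.aestronglyMeasurable]

end Density

namespace MmWave

open Set Filter Topology

/-! ### Received powers -/

section Power

variable {c h α : ℝ}

lemma measurable_const_mul_sqrt_rpow (c h α : ℝ) :
    Measurable fun x : Plane => c * (Real.sqrt (‖x‖ ^ 2 + h ^ 2)) ^ (-α) := by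
  fun_prop

lemma norm_le_sqrt_norm_sq_add_sq (x : Plane) (h : ℝ) : ‖x‖ ≤ Real.sqrt (‖x‖ ^ 2 + h ^ 2) :=
  Real.le_sqrt_of_sq_le (by nlinarith [sq_nonneg h])

lemma const_mul_sqrt_rpow_le (hc : 0 < c) (hh : 0 < h) (hα : 0 < α) (x : Plane) :
    c * (Real.sqrt (‖x‖ ^ 2 + h ^ 2)) ^ (-α) ≤ c * h ^ (-α) := by
  refine mul_le_mul_of_nonneg_left ?_ hc.le
  refine Real.rpow_le_rpow_of_nonpos hh ?_ (by linarith)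
  exact Real.le_sqrt_of_sq_le (by nlinarith [sq_nonneg ‖x‖])

lemma exists_superlevel_subset_closedBall (hα : 0 < α) {q : ℝ} (hq : 0 < q) :
    ∃ ρ : ℝ, {x : Plane | q ≤ c * (Real.sqrt (‖x‖ ^ 2 + h ^ 2)) ^ (-α)}
      ⊆ Metric.closedBall 0 ρ := by
  have ht : Tendsto (fun y : ℝ => c * y ^ (-α)) atTop (𝓝 0) := by
    simpa using (tendsto_rpow_neg_atTop hα).const_mul c
  obtain ⟨ρ, hρ⟩ := eventually_atTop.1 (ht.eventually (gt_mem_nhds hq))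
  refine ⟨ρ, fun x hx => ?_⟩
  rw [mem_closedBall_zero_iff]
  by_contra! hlt
  have hx' : q ≤ c * (Real.sqrt (‖x‖ ^ 2 + h ^ 2)) ^ (-α) := hx
  linarith [hρ _ (hlt.le.trans (norm_le_sqrt_norm_sq_add_sq x h))]

/-- Path loss confines strong stations to a ball, where a bounded intensity has finite mass. -/
lemma withDensity_superlevel_ne_top {f : Plane → ENNReal} {C : ℝ}
    (hf : ∀ x, f x ≤ ENNReal.ofReal C) (hα : 0 < α) {q : ℝ} (hq : 0 < q) :
    (volume.withDensity f) {x : Plane | q ≤ c * (Real.sqrt (‖x‖ ^ 2 + h ^ 2)) ^ (-α)} ≠ ⊤ := by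
  obtain ⟨ρ, hρ⟩ := exists_superlevel_subset_closedBall (c := c) (h := h) hα hq
  refine ((measure_mono hρ).trans_lt ?_).ne
  rw [withDensity_apply _ Metric.isClosed_closedBall.measurableSet]
  calc ∫⁻ x in Metric.closedBall 0 ρ, f x
      ≤ ∫⁻ _ in Metric.closedBall (0 : Plane) ρ, ENNReal.ofReal C := lintegral_mono fun x => hf x
    _ = ENNReal.ofReal C * volume (Metric.closedBall (0 : Plane) ρ) := by simp
    _ < ⊤ := ENNReal.mul_lt_top ENNReal.ofReal_lt_top Metric.isBounded_closedBall.measure_lt_top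

end Power

namespace Params

variable (P : Params)

lemma measurable_powerL : Measurable P.powerL := measurable_const_mul_sqrt_rpow _ _ _

lemma measurable_powerN : Measurable P.powerN := measurable_const_mul_sqrt_rpow _ _ _

lemma measurable_powerT : Measurable P.powerT := by
  unfold powerT
  fun_prop

lemma powerT_pos {r : ℝ} (hr : 0 < r) : 0 < P.powerT r := by
  have := P.GM_pos
  have := P.PT_pos
  have := P.CT_pos
  unfold powerT
  positivity

lemma intensityL_superlevel_ne_top {q : ℝ} (hq : 0 < q) :
    P.intensityL {x | q ≤ P.powerL x} ≠ ⊤ := by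
  refine withDensity_superlevel_ne_top (C := P.lamA) (fun x => ?_) P.alphaL_pos hq
  exact ENNReal.ofReal_le_ofReal (mul_le_of_le_one_right P.lamA_pos.le (P.pLoS_le_one _))

lemma intensityN_superlevel_ne_top {q : ℝ} (hq : 0 < q) :
    P.intensityN {x | q ≤ P.powerN x} ≠ ⊤ := by
  refine withDensity_superlevel_ne_top (C := P.lamA) (fun x => ?_) P.alphaN_pos hq
  exact ENNReal.ofReal_le_ofReal (mul_le_of_le_one_right P.lamA_pos.le
    (by linarith [P.pLoS_nonneg ‖x‖]))

lemma powerL_le (x : Plane) : P.powerL x ≤ P.an * P.PA * P.CL * P.h ^ (-P.alphaL) :=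
  const_mul_sqrt_rpow_le (mul_pos (mul_pos P.an_pos P.PA_pos) P.CL_pos) P.h_pos P.alphaL_pos x

lemma powerN_le (x : Plane) : P.powerN x ≤ P.an * P.PA * P.CN * P.h ^ (-P.alphaN) :=
  const_mul_sqrt_rpow_le (mul_pos (mul_pos P.an_pos P.PA_pos) P.CN_pos) P.h_pos P.alphaN_pos x

/-- Close to the user, a terrestrial base station beats every aerial one. -/
lemma exists_forall_power_lt : ∃ δ : ℝ, 0 < δ ∧ δ ≤ P.RB ∧ ∀ r : ℝ, 0 < r → r ≤ δ →
    (∀ x, P.powerL x < P.powerT r) ∧ ∀ x, P.powerN x < P.powerT r := by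
  have ht : Tendsto P.powerT (𝓝[>] 0) atTop :=
    (tendsto_rpow_neg_nhdsGT_zero (neg_lt_zero.2 P.alphaT_pos)).const_mul_atTop
      (mul_pos (mul_pos P.GM_pos P.PT_pos) P.CT_pos)
  have hev := (ht.eventually (eventually_gt_atTop (P.an * P.PA * P.CL * P.h ^ (-P.alphaL)))).and
    (ht.eventually (eventually_gt_atTop (P.an * P.PA * P.CN * P.h ^ (-P.alphaN))))
  obtain ⟨u, hu, hsub⟩ := mem_nhdsGT_iff_exists_Ioc_subset.1 hev
  have hu' : 0 < u := hu
  refine ⟨min u P.RB, lt_min hu' P.RB_pos, min_le_right _ _, fun r hr hrδ => ?_⟩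
  have h := hsub ⟨hr, hrδ.trans (min_le_left _ _)⟩
  exact ⟨fun x => (P.powerL_le x).trans_lt h.1, fun x => (P.powerN_le x).trans_lt h.2⟩

lemma epsT_pos : 0 < P.epsT :=
  div_pos P.nuT_pos (mul_pos (mul_pos P.GM_pos P.PT_pos) P.CT_pos)

lemma fadingLaw_Ici {τ : ℝ} (hτ : 0 ≤ τ) :
    P.fadingLaw (Ici τ) = ENNReal.ofReal (erlangTail P.mT (P.mT * τ)) := by
  have hm := P.mT_pos
  have hm' : (0 : ℝ) < P.mT := by exact_mod_cast hm
  obtain ⟨n, hn⟩ : ∃ n, P.mT = n + 1 := ⟨P.mT - 1, by omega⟩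
  have := gammaMeasure_Ici n hm' hτ
  rw [← hn] at this
  exact this

lemma fadingLaw_Iio_zero : P.fadingLaw (Iio 0) = 0 := by
  rw [fadingLaw, gammaMeasure, withDensity_apply _ measurableSet_Iio]
  exact lintegral_gammaPDF_of_nonpos le_rfl

lemma gainLaw_Iio_zero : P.gainLaw (Iio 0) = 0 := by
  simp [gainLaw, P.GM_pos.le, P.Gm_nonneg]

lemma bT_pos : 0 < P.bT := by
  have : (0 : ℝ) < P.mT := by exact_mod_cast P.mT_pos
  unfold bT
  positivity

end Params

namespace Network

variable {P : Params} {Ω : Type*} [MeasurableSpace Ω] {μ : Measure Ω} (N : Network P μ)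

/-! ### The serving distance -/

lemma measurable_R : Measurable N.R := (N.measurable_X 0).norm

/-- A Lebesgue-null set of radii lifts to a null set of the plane, which almost surely contains no
station at all. No formula for the law of `R` is needed. -/
lemma map_R_absolutelyContinuous [IsProbabilityMeasure μ] : μ.map N.R ≪ volume := by
  refine Measure.AbsolutelyContinuous.mk fun S hS h0 => ?_
  rw [Measure.map_apply N.measurable_R hS, measure_eq_zero_iff_ae_notMem]
  have hΛ : P.intensityT {x | ‖x‖ ∈ S} = 0 := by
    rw [Params.intensityT, Measure.smul_apply, addHaar_norm_preimage_eq_zero volume h0, smul_zero]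
  filter_upwards [N.poisson_T.ae_inter_eq_empty (measurable_norm hS) hΛ] with ω hω hR
  have : N.X 0 ω ∈ range (fun i => N.X i ω) ∩ {x | ‖x‖ ∈ S} := ⟨⟨0, rfl⟩, hR⟩
  exact (eq_empty_iff_forall_notMem.1 hω) _ this

lemma ae_R_pos [IsProbabilityMeasure μ] : ∀ᵐ ω ∂μ, 0 < N.R ω := by
  have h : μ.map N.R {0} = 0 := N.map_R_absolutelyContinuous (by simp)
  rw [Measure.map_apply N.measurable_R (measurableSet_singleton _),
    measure_eq_zero_iff_ae_notMem] at h
  filter_upwards [h] with ω hω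
  exact (norm_nonneg _).lt_of_ne fun h => hω h.symm

/-- Otherwise the ball of radius `δ` would almost surely be empty, whereas its void probability is
`exp (-Λ) < 1`. -/
lemma measure_R_le_pos [IsProbabilityMeasure μ] {δ : ℝ} (hδ : 0 < δ) :
    0 < μ {ω | N.R ω ≤ δ} := by
  rw [pos_iff_ne_zero]
  intro h0
  have hB : MeasurableSet (Metric.closedBall (0 : Plane) δ) :=
    Metric.isClosed_closedBall.measurableSet
  have hvol : P.intensityT (Metric.closedBall 0 δ) ≠ ⊤ := by
    rw [Params.intensityT, Measure.smul_apply]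
    exact ENNReal.mul_ne_top ENNReal.ofReal_ne_top
      Metric.isBounded_closedBall.measure_lt_top.ne
  have hpos : 0 < P.intensityT (Metric.closedBall 0 δ) := by
    rw [Params.intensityT, Measure.smul_apply]
    exact ENNReal.mul_pos (by simpa using P.lamT_pos)
      (Metric.measure_closedBall_pos volume _ hδ).ne'
  have h1 := N.poisson_T.measure_count_eq_zero hB hvol
  have h2 : μ {ω | pointCount (fun ω => range fun i => N.X i ω)
      (Metric.closedBall 0 δ) ω = 0} = 1 := by
    rw [← measure_univ (μ := μ)]
    refine measure_congr (eventuallyEq_univ.2 ?_)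
    filter_upwards [measure_eq_zero_iff_ae_notMem.1 h0, N.strictMono_norm_X] with ω hω hmono
    simp only [pointCount, encard_eq_zero]
    rw [eq_empty_iff_forall_notMem]
    rintro _ ⟨⟨i, rfl⟩, hi⟩
    rw [mem_closedBall_zero_iff] at hi
    have h3 : ‖N.X 0 ω‖ ≤ ‖N.X i ω‖ := hmono.monotone (Nat.zero_le i)
    exact hω (h3.trans hi)
  rw [h2] at h1
  have h3 : Real.exp (-(P.intensityT (Metric.closedBall 0 δ)).toReal) < 1 := by
    rw [Real.exp_lt_one_iff, neg_lt_zero]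
    exact ENNReal.toReal_pos hpos.ne' hvol
  have := ENNReal.ofReal_lt_one.2 h3
  rw [← h1] at this
  exact lt_irrefl _ this

/-! ### The association event -/

/-- Numbers of aerial base stations received above each rational power level. -/
noncomputable def aerialCount (ω : Ω) : (ℚ → ℕ∞) × (ℚ → ℕ∞) :=
  (superlevelCount P.powerL N.PhiL ω, superlevelCount P.powerN N.PhiN ω)

lemma measurable_aerialCount : Measurable N.aerialCount :=
  ((measurable_superlevelCount P.measurable_powerL).mono N.poisson_L.pointSigma_le le_rfl).prodMk
    ((measurable_superlevelCount P.measurable_powerN).mono N.poisson_N.pointSigma_le le_rfl)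

/-- The association event in terms of the serving distance and of the aerial counts. -/
def assocRegion (P : Params) : Set (ℝ × ((ℚ → ℕ∞) × (ℚ → ℕ∞))) :=
  {z | z.1 ≤ P.RB ∧ (∃ q : ℚ, (q : ℝ) < P.powerT z.1 ∧ z.2.1 q = 0) ∧
    ∃ q : ℚ, (q : ℝ) < P.powerT z.1 ∧ z.2.2 q = 0}

lemma measurableSet_assocRegion (P : Params) : MeasurableSet (assocRegion P) := by
  have h1 : MeasurableSet (⋃ q : ℚ, {z : ℝ × ((ℚ → ℕ∞) × (ℚ → ℕ∞)) |
      (q : ℝ) < P.powerT z.1 ∧ z.2.1 q = 0}) :=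
    MeasurableSet.iUnion fun q =>
      (measurableSet_lt measurable_const (P.measurable_powerT.comp measurable_fst)).inter
        (((measurable_pi_apply q).comp (measurable_fst.comp measurable_snd))
          (measurableSet_singleton 0))
  have h2 : MeasurableSet (⋃ q : ℚ, {z : ℝ × ((ℚ → ℕ∞) × (ℚ → ℕ∞)) |
      (q : ℝ) < P.powerT z.1 ∧ z.2.2 q = 0}) :=
    MeasurableSet.iUnion fun q =>
      (measurableSet_lt measurable_const (P.measurable_powerT.comp measurable_fst)).inter
        (((measurable_pi_apply q).comp (measurable_snd.comp measurable_snd))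
          (measurableSet_singleton 0))
  have h := (measurableSet_le (measurable_fst (α := ℝ) (β := (ℚ → ℕ∞) × (ℚ → ℕ∞)))
    (measurable_const (a := P.RB))).inter (h1.inter h2)
  convert h using 1
  ext z
  simp [assocRegion]

/-- A measurable version of the association event. -/
def assocSet : Set Ω := (fun ω => (N.R ω, N.aerialCount ω)) ⁻¹' assocRegion P

lemma measurableSet_assocSet : MeasurableSet N.assocSet :=
  (N.measurable_R.prodMk N.measurable_aerialCount) (measurableSet_assocRegion P)

/-- `assocT` quantifies over the points of random sets, so its measurability is not evident. The
substitute uses countably many counts, which are also what the independence hypothesis controls. -/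
lemma assocT_ae_eq [IsProbabilityMeasure μ] : N.assocT =ᵐ[μ] N.assocSet := by
  filter_upwards [N.ae_R_pos,
    N.poisson_L.ae_forall_lt_iff P.measurable_powerL fun q => P.intensityL_superlevel_ne_top,
    N.poisson_N.ae_forall_lt_iff P.measurable_powerN fun q => P.intensityN_superlevel_ne_top]
    with ω hR hL hN
  have hp := P.powerT_pos hR
  have h : ω ∈ N.assocT ↔ ω ∈ N.assocSet :=
    and_congr Iff.rfl (and_congr (hL _ hp) (hN _ hp))
  exact propext h

/-- For a small enough serving distance association is automatic, whatever the aerial processes do;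
independence plays no role. -/
lemma measure_assocT_pos [IsProbabilityMeasure μ] : 0 < μ N.assocT := by
  obtain ⟨δ, hδ, hδB, hlt⟩ := P.exists_forall_power_lt
  refine (N.measure_R_le_pos hδ).trans_le (measure_mono_ae ?_)
  filter_upwards [N.ae_R_pos] with ω hR hRδ
  have hRδ' : N.R ω ≤ δ := hRδ
  exact ⟨hRδ'.trans hδB, fun x _ => (hlt _ hR hRδ').1 x, fun x _ => (hlt _ hR hRδ').2 x⟩

lemma cond_assocT_eq [IsProbabilityMeasure μ] : cond μ N.assocT = cond μ N.assocSet := by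
  rw [ProbabilityTheory.cond, ProbabilityTheory.cond, measure_congr N.assocT_ae_eq, Measure.restrict_congr_set N.assocT_ae_eq]

lemma isProbabilityMeasure_cond [IsProbabilityMeasure μ] :
    IsProbabilityMeasure (cond μ N.assocT) :=
  cond_isProbabilityMeasure N.measure_assocT_pos.ne'

lemma integral_cond_assocT [IsProbabilityMeasure μ] (f : Ω → ℝ) :
    ∫ ω, f ω ∂(cond μ N.assocT) = (μ N.assocSet).toReal⁻¹ * ∫ ω in N.assocSet, f ω ∂μ := by
  rw [cond_assocT_eq, ProbabilityTheory.cond, integral_smul_measure, ENNReal.toReal_inv, smul_eq_mul]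

lemma cond_assocT_absolutelyContinuous : cond μ N.assocT ≪ μ :=
  cond_absolutelyContinuous

lemma hasPDF_R [IsProbabilityMeasure μ] : HasPDF N.R (cond μ N.assocT) volume := by
  have := N.isProbabilityMeasure_cond
  rw [Real.hasPDF_iff_of_aemeasurable N.measurable_R.aemeasurable]
  exact (N.cond_assocT_absolutelyContinuous.map N.measurable_R).trans
    N.map_R_absolutelyContinuous

lemma ae_cond_R_mem [IsProbabilityMeasure μ] : ∀ᵐ ω ∂(cond μ N.assocT), N.R ω ∈ Ioc 0 P.RB := by
  have h1 : ∀ᵐ ω ∂(cond μ N.assocT), ω ∈ N.assocSet := by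
    rw [cond_assocT_eq]
    exact ae_cond_mem N.measurableSet_assocSet
  filter_upwards [h1, N.cond_assocT_absolutelyContinuous.ae_le N.ae_R_pos] with ω h hR
  exact ⟨hR, h.1⟩

/-! ### The interference -/

lemma ae_H_nonneg : ∀ᵐ ω ∂μ, ∀ i, 0 ≤ N.H i ω := by
  rw [ae_all_iff]
  intro i
  have h := P.fadingLaw_Iio_zero
  rw [← N.law_H i, Measure.map_apply (N.measurable_H i) measurableSet_Iio,
    measure_eq_zero_iff_ae_notMem] at h
  filter_upwards [h] with ω hω
  exact not_lt.1 hω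

lemma ae_G_nonneg : ∀ᵐ ω ∂μ, ∀ i, 0 ≤ N.G i ω := by
  rw [ae_all_iff]
  intro i
  have h := P.gainLaw_Iio_zero
  rw [← N.law_G i, Measure.map_apply (N.measurable_G i) measurableSet_Iio,
    measure_eq_zero_iff_ae_notMem] at h
  filter_upwards [h] with ω hω
  exact not_lt.1 hω

/-- The interference as a function of the locations, the beamforming gains, and the channel gains
of the interferers. -/
noncomputable def interference (P : Params) (z : (ℕ → Plane) × (ℕ → ℝ) × (ℕ → ℝ)) : ℝ :=
  ∑' i : ℕ, if ‖z.1 (i + 1)‖ ≤ P.RB then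
    z.2.1 (i + 1) * P.PT * P.CT * ‖z.1 (i + 1)‖ ^ (-P.alphaT) * z.2.2 i else 0

lemma measurable_interference (P : Params) : Measurable (interference P) := by
  unfold interference
  refine Measurable.tsum fun i => ?_
  have hn : Measurable fun z : (ℕ → Plane) × (ℕ → ℝ) × (ℕ → ℝ) => ‖z.1 (i + 1)‖ :=
    ((measurable_pi_apply (i + 1)).comp measurable_fst).norm
  have hg : Measurable fun z : (ℕ → Plane) × (ℕ → ℝ) × (ℕ → ℝ) => z.2.1 (i + 1) :=
    (measurable_pi_apply (i + 1)).comp (measurable_fst.comp measurable_snd)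
  have hh : Measurable fun z : (ℕ → Plane) × (ℕ → ℝ) × (ℕ → ℝ) => z.2.2 i :=
    (measurable_pi_apply i).comp (measurable_snd.comp measurable_snd)
  exact Measurable.ite (measurableSet_le hn measurable_const)
    ((((hg.mul_const _).mul_const _).mul (hn.pow_const _)).mul hh) measurable_const

lemma I_eq_interference : N.I = fun ω =>
    interference P ((fun i => N.X i ω), (fun i => N.G i ω), fun i => N.H (i + 1) ω) := rfl

lemma measurable_I : Measurable N.I := by
  rw [I_eq_interference]
  exact (measurable_interference P).comp ((measurable_pi_lambda _ N.measurable_X).prodMk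
    ((measurable_pi_lambda _ N.measurable_G).prodMk
      (measurable_pi_lambda _ fun i => N.measurable_H (i + 1))))

lemma ae_I_nonneg : ∀ᵐ ω ∂μ, 0 ≤ N.I ω := by
  filter_upwards [N.ae_H_nonneg, N.ae_G_nonneg] with ω hH hG
  refine tsum_nonneg fun i => ?_
  have := P.PT_pos
  have := P.CT_pos
  have := hH (i + 1)
  have := hG (i + 1)
  split_ifs <;> positivity

/-! ### Independence -/

lemma sigma_le (i : Fin 5) :
    (![MeasurableSpace.comap (fun ω i => N.X i ω) inferInstance,
      MeasurableSpace.comap (fun ω i => N.H i ω) inferInstance,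
      MeasurableSpace.comap (fun ω i => N.G i ω) inferInstance,
      pointSigma N.PhiL, pointSigma N.PhiN] : Fin 5 → MeasurableSpace Ω) i
      ≤ (inferInstance : MeasurableSpace Ω) := by
  fin_cases i
  · exact (measurable_pi_lambda _ N.measurable_X).comap_le
  · exact (measurable_pi_lambda _ N.measurable_H).comap_le
  · exact (measurable_pi_lambda _ N.measurable_G).comap_le
  · exact N.poisson_L.pointSigma_le
  · exact N.poisson_N.pointSigma_le

lemma indepFun_terrestrial_aerialCount :
    IndepFun (fun ω => ((fun i => N.X i ω), (fun i => N.H i ω), fun i => N.G i ω))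
      N.aerialCount μ := by
  -- The indices `0, 1, 2, 3, 4` stand for locations, channel gains, beamforming gains, LoS and NLoS
  -- processes.
  have h := indep_iSup_of_disjoint N.sigma_le N.indep_all
    (S := {0, 1, 2}) (T := {3, 4}) (by simp)
  rw [IndepFun_iff_Indep]
  refine indep_of_indep_of_le_left (indep_of_indep_of_le_right h ?_) ?_
  · refine Measurable.comap_le (Measurable.prodMk ?_ ?_)
    · exact (measurable_superlevelCount P.measurable_powerL).mono
        (le_iSup₂_of_le (3 : Fin 5) (by simp) le_rfl) le_rfl
    · exact (measurable_superlevelCount P.measurable_powerN).mono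
        (le_iSup₂_of_le (4 : Fin 5) (by simp) le_rfl) le_rfl
  · refine Measurable.comap_le (Measurable.prodMk ?_ (Measurable.prodMk ?_ ?_))
    · exact (comap_measurable _).mono (le_iSup₂_of_le (0 : Fin 5) (by simp) le_rfl) le_rfl
    · exact (comap_measurable _).mono (le_iSup₂_of_le (1 : Fin 5) (by simp) le_rfl) le_rfl
    · exact (comap_measurable _).mono (le_iSup₂_of_le (2 : Fin 5) (by simp) le_rfl) le_rfl

lemma indepFun_H_rest :
    IndepFun (fun ω i => N.H i ω)
      (fun ω => ((fun i => N.X i ω), (fun i => N.G i ω), N.aerialCount ω)) μ := by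
  have h := indep_iSup_of_disjoint N.sigma_le N.indep_all
    (S := {1}) (T := {0, 2, 3, 4}) (by simp)
  rw [IndepFun_iff_Indep]
  refine indep_of_indep_of_le_left (indep_of_indep_of_le_right h ?_) ?_
  · refine Measurable.comap_le
      (Measurable.prodMk ?_ (Measurable.prodMk ?_ (Measurable.prodMk ?_ ?_)))
    · exact (comap_measurable _).mono (le_iSup₂_of_le (0 : Fin 5) (by simp) le_rfl) le_rfl
    · exact (comap_measurable _).mono (le_iSup₂_of_le (2 : Fin 5) (by simp) le_rfl) le_rfl
    · exact (measurable_superlevelCount P.measurable_powerL).mono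
        (le_iSup₂_of_le (3 : Fin 5) (by simp) le_rfl) le_rfl
    · exact (measurable_superlevelCount P.measurable_powerN).mono
        (le_iSup₂_of_le (4 : Fin 5) (by simp) le_rfl) le_rfl
  · exact le_iSup₂_of_le (1 : Fin 5) (by simp) le_rfl

/-- The interference involves only the gains `H (i + 1)`, so this separates it from the serving
gain. -/
lemma indepFun_H_zero_H_succ : IndepFun (N.H 0) (fun ω i => N.H (i + 1) ω) μ := by
  have h := indep_iSup_of_disjoint (fun i => (N.measurable_H i).comap_le)
    ((iIndepFun_iff_iIndep _ _ _).1 N.indep_H) (S := {0}) (T := {0}ᶜ) disjoint_compl_right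
  rw [IndepFun_iff_Indep]
  refine indep_of_indep_of_le_left (indep_of_indep_of_le_right h ?_) ?_
  · refine Measurable.comap_le (@measurable_pi_lambda _ _ _
      (⨆ i ∈ ({0}ᶜ : Set ℕ), MeasurableSpace.comap (N.H i) inferInstance) _ _ fun i => ?_)
    exact (comap_measurable _).mono (le_iSup₂_of_le (i + 1) (by simp) le_rfl) le_rfl
  · exact le_iSup₂_of_le 0 (by simp) le_rfl

lemma indepFun_R_I_aerialCount :
    IndepFun (fun ω => (N.R ω, N.I ω)) N.aerialCount μ := by
  rw [I_eq_interference]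
  have hφ : Measurable fun z : (ℕ → Plane) × (ℕ → ℝ) × (ℕ → ℝ) =>
      (‖z.1 0‖, interference P (z.1, z.2.2, fun i => z.2.1 (i + 1))) := by
    refine Measurable.prodMk ((measurable_pi_apply 0).comp measurable_fst).norm
      ((measurable_interference P).comp ?_)
    exact measurable_fst.prodMk ((measurable_snd.comp measurable_snd).prodMk
      (measurable_pi_lambda _ fun i =>
        (measurable_pi_apply (i + 1)).comp (measurable_fst.comp measurable_snd)))
  exact N.indepFun_terrestrial_aerialCount.comp hφ measurable_id

lemma indepFun_R_I_aerialCount_H [IsProbabilityMeasure μ] :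
    IndepFun (fun ω => ((N.R ω, N.I ω), N.aerialCount ω)) (N.H 0) μ := by
  have hs : Measurable fun h : ℕ → ℝ => (h 0, fun i : ℕ => h (i + 1)) :=
    (measurable_pi_apply 0).prodMk (measurable_pi_lambda _ fun i => measurable_pi_apply (i + 1))
  have h1 : IndepFun (fun ω => (N.H 0 ω, fun i => N.H (i + 1) ω))
      (fun ω => ((fun i => N.X i ω), (fun i => N.G i ω), N.aerialCount ω)) μ :=
    N.indepFun_H_rest.comp hs measurable_id
  have h2 := N.indepFun_H_zero_H_succ.prodMk_right_of_prodMk_left (N.measurable_H 0)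
    (measurable_pi_lambda _ fun i => N.measurable_H (i + 1))
    ((measurable_pi_lambda _ N.measurable_X).prodMk
      ((measurable_pi_lambda _ N.measurable_G).prodMk N.measurable_aerialCount)) h1
  rw [I_eq_interference]
  have hφ : Measurable fun z : (ℕ → ℝ) × (ℕ → Plane) × (ℕ → ℝ) × ((ℚ → ℕ∞) × (ℚ → ℕ∞)) =>
      ((‖z.2.1 0‖, interference P (z.2.1, z.2.2.1, z.1)), z.2.2.2) := by
    refine Measurable.prodMk (Measurable.prodMk
      ((measurable_pi_apply 0).comp (measurable_fst.comp measurable_snd)).norm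
      ((measurable_interference P).comp ?_))
      (measurable_snd.comp (measurable_snd.comp measurable_snd))
    exact (measurable_fst.comp measurable_snd).prodMk
      ((measurable_fst.comp (measurable_snd.comp measurable_snd)).prodMk measurable_fst)
  exact (h2.comp measurable_id hφ).symm

end Network

end MmWave

namespace MmWave

open Set Filter Topology

namespace Network

variable {P : Params} {Ω : Type*} [MeasurableSpace Ω] {μ : Measure Ω} (N : Network P μ)

/-! ### Averaging over the interference -/

/-- The normalized threshold that the channel gain of the serving station has to exceed when the
serving distance is `z.1` and the interference is `z.2`. -/
noncomputable def threshold (P : Params) (z : ℝ × ℝ) : ℝ :=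
  z.1 ^ P.alphaT * P.epsT * (z.2 + P.noiseT)

lemma measurable_threshold (P : Params) : Measurable (threshold P) :=
  ((measurable_fst.pow_const _).mul_const _).mul (measurable_snd.add_const _)

lemma threshold_nonneg {z : ℝ × ℝ} (h1 : 0 ≤ z.1) (h2 : 0 ≤ z.2) : 0 ≤ threshold P z :=
  mul_nonneg (mul_nonneg (Real.rpow_nonneg h1 _) P.epsT_pos.le) (add_nonneg h2 P.noiseT_pos.le)

lemma ae_threshold_nonneg [IsProbabilityMeasure μ] :
    ∀ᵐ ω ∂μ, 0 ≤ threshold P (N.R ω, N.I ω) := by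
  filter_upwards [N.ae_R_pos, N.ae_I_nonneg] with ω h1 h2 using threshold_nonneg h1.le h2

section Transfer

variable [IsProbabilityMeasure μ] {Q : ℝ → ℝ}

lemma integrable_comp_threshold (hQ : Measurable Q) (hQ1 : ∀ τ, 0 ≤ τ → |Q τ| ≤ 1) :
    Integrable (fun ω => Q (threshold P (N.R ω, N.I ω))) μ := by
  refine Integrable.of_bound (C := 1) (hQ.comp ((measurable_threshold P).comp
    (N.measurable_R.prodMk N.measurable_I))).aestronglyMeasurable ?_
  filter_upwards [N.ae_threshold_nonneg] with ω hω using hQ1 _ hω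

lemma integrable_cond_comp_threshold (hQ : Measurable Q) (hQ1 : ∀ τ, 0 ≤ τ → |Q τ| ≤ 1) :
    Integrable (fun ω => Q (threshold P (N.R ω, N.I ω))) (cond μ N.assocT) := by
  have := N.isProbabilityMeasure_cond
  refine Integrable.of_bound (C := 1) (hQ.comp ((measurable_threshold P).comp
    (N.measurable_R.prodMk N.measurable_I))).aestronglyMeasurable ?_
  filter_upwards [N.cond_assocT_absolutelyContinuous.ae_le N.ae_threshold_nonneg]
    with ω hω using hQ1 _ hω

/-- The Laplace identities need a conditional law carried by `[0, ∞)`; this is available only for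
almost every `r`. -/
lemma ae_condDistrib_nonneg : ∀ᵐ r ∂(μ.map N.R), ∀ᵐ y ∂(condDistrib N.I N.R μ r), 0 ≤ y := by
  refine Measure.ae_ae_of_ae_compProd (p := fun z : ℝ × ℝ => 0 ≤ z.2) ?_
  rw [compProd_map_condDistrib N.measurable_I.aemeasurable,
    ae_map_iff (N.measurable_R.prodMk N.measurable_I).aemeasurable
      (measurableSet_le measurable_const measurable_snd)]
  exact N.ae_I_nonneg

/-- A bounded function of the threshold may be averaged over the interference given the serving
distance, and then over the serving distance. -/
lemma intervalIntegral_mul_servingPDF (hQ : Measurable Q) (hQ1 : ∀ τ, 0 ≤ τ → |Q τ| ≤ 1)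
    {f : ℝ → ℝ} (hf : ∀ r, 0 < r → (∀ᵐ y ∂(condDistrib N.I N.R μ r), 0 ≤ y) →
      f r = ∫ y, Q (threshold P (r, y)) ∂(condDistrib N.I N.R μ r)) :
    IntervalIntegrable (fun r => f r * N.servingPDF r) volume 0 P.RB ∧
      ∫ ω, Q (threshold P (N.R ω, N.I ω)) ∂(cond μ N.assocT) =
        ∫ r in (0 : ℝ)..P.RB, f r * N.servingPDF r := by
  have hcond := N.isProbabilityMeasure_cond
  have hpdf := N.hasPDF_R
  have hq : Measurable fun z : ℝ × ℝ => Q (threshold P z) := hQ.comp (measurable_threshold P)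
  set T : ℝ → ℝ := fun r => ∫ y, Q (threshold P (r, y)) ∂(condDistrib N.I N.R μ r) with hT
  have hTm : Measurable T :=
    (hq.stronglyMeasurable.integral_kernel_prod_right'
      (κ := condDistrib N.I N.R μ)).measurable
  have hpos : ∀ᵐ r ∂(μ.map N.R), 0 < r :=
    (ae_map_iff N.measurable_R.aemeasurable measurableSet_Ioi).2 N.ae_R_pos
  have hmapac : (cond μ N.assocT).map N.R ≪ μ.map N.R :=
    N.cond_assocT_absolutelyContinuous.map N.measurable_R
  have hTb : ∀ᵐ r ∂(μ.map N.R), ‖T r‖ ≤ 1 := by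
    filter_upwards [hpos, N.ae_condDistrib_nonneg] with r hr hy
    refine (norm_integral_le_of_norm_le_const (C := 1) ?_).trans (by simp)
    filter_upwards [hy] with y hy
    exact hQ1 _ (threshold_nonneg hr.le hy)
  have hfT : f =ᵐ[(cond μ N.assocT).map N.R] T := by
    refine hmapac.ae_le ?_
    filter_upwards [hpos, N.ae_condDistrib_nonneg] with r hr hy using hf r hr hy
  have hTint : Integrable (fun ω => T (N.R ω)) (cond μ N.assocT) := by
    refine Integrable.of_bound (C := 1) (hTm.comp N.measurable_R).aestronglyMeasurable ?_
    exact N.cond_assocT_absolutelyContinuous.ae_le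
      (ae_of_ae_map N.measurable_R.aemeasurable hTb)
  obtain ⟨h1, h2⟩ := intervalIntegral_mul_pdf N.measurable_R P.RB_pos.le N.ae_cond_R_mem hTm hfT
    hTint
  refine ⟨h1, ?_⟩
  refine Eq.trans ?_ h2.symm
  rw [integral_cond_assocT, integral_cond_assocT]
  congr 1
  -- The aerial counts are independent of `(R, I)`, so association does not bias `I` once `R` is
  -- known.
  exact setIntegral_eq_setIntegral_integral_kernel N.measurable_R N.measurable_I
    N.measurable_aerialCount N.indepFun_R_I_aerialCount (condDistrib N.I N.R μ)
    (compProd_map_condDistrib N.measurable_I.aemeasurable) (measurableSet_assocRegion P) hq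
    (N.integrable_comp_threshold hQ hQ1)

end Transfer

/-! ### The coverage probability -/

lemma nuT_le_sinrT_iff {ω : Ω} (hR : 0 < N.R ω) (hI : 0 ≤ N.I ω) :
    P.nuT ≤ N.sinrT ω ↔ threshold P (N.R ω, N.I ω) ≤ N.H 0 ω := by
  have hG := P.GM_pos
  have hP := P.PT_pos
  have hC := P.CT_pos
  have hden : 0 < N.I ω + P.noiseT := add_pos_of_nonneg_of_pos hI P.noiseT_pos
  have hr : 0 < N.R ω ^ P.alphaT := Real.rpow_pos_of_pos hR _
  rw [sinrT, le_div_iff₀ hden, threshold, Params.epsT, Real.rpow_neg hR.le]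
  have e1 : P.GM * P.PT * P.CT * (N.R ω ^ P.alphaT)⁻¹ * N.H 0 ω =
      (P.GM * P.PT * P.CT) * N.H 0 ω / N.R ω ^ P.alphaT := by field_simp
  have e2 : N.R ω ^ P.alphaT * (P.nuT / (P.GM * P.PT * P.CT)) * (N.I ω + P.noiseT) =
      P.nuT * (N.I ω + P.noiseT) * N.R ω ^ P.alphaT / (P.GM * P.PT * P.CT) := by field_simp
  rw [e1, e2, le_div_iff₀ hr, div_le_iff₀ (by positivity), mul_comm (N.H 0 ω)]

lemma coverageT_eq [IsProbabilityMeasure μ] :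
    N.coverageT = ∫ ω, erlangTail P.mT (P.mT * threshold P (N.R ω, N.I ω))
      ∂(cond μ N.assocT) := by
  have hm : (0 : ℝ) ≤ P.mT := Nat.cast_nonneg _
  -- Association ignores the interference coordinate `z.1.2`, while the threshold depends on it.
  have hM : MeasurableSet {z : (ℝ × ℝ) × ((ℚ → ℕ∞) × (ℚ → ℕ∞)) | (z.1.1, z.2) ∈ assocRegion P} :=
    ((measurable_fst.comp measurable_fst).prodMk measurable_snd) (measurableSet_assocRegion P)
  have key := measureReal_threshold_eq_setIntegral
    ((N.measurable_R.prodMk N.measurable_I).prodMk N.measurable_aerialCount) (N.measurable_H 0)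
    N.indepFun_R_I_aerialCount_H hM
    (τ := fun z => threshold P z.1) ((measurable_threshold P).comp measurable_fst)
    (Q := fun τ => erlangTail P.mT (P.mT * τ))
    ((continuous_erlangTail _).measurable.comp (measurable_const_mul _)) ?_ ?_
  · rw [integral_cond_assocT, coverageT, cond_assocT_eq, measureReal_def,
      cond_apply N.measurableSet_assocSet, ENNReal.toReal_mul, ENNReal.toReal_inv]
    congr 1
    refine Eq.trans ?_ key
    rw [measureReal_def]
    congr 1
    refine measure_congr ?_
    filter_upwards [N.ae_R_pos, N.ae_I_nonneg] with ω hR hI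
    exact propext (and_congr Iff.rfl (N.nuT_le_sinrT_iff hR hI))
  · filter_upwards [N.ae_threshold_nonneg] with ω hω
    rw [N.law_H 0, P.fadingLaw_Ici hω]
  · filter_upwards [N.ae_threshold_nonneg] with ω hω
    exact erlangTail_nonneg _ (mul_nonneg hm hω)

lemma abs_erlangTail_le_one (P : Params) {τ : ℝ} (hτ : 0 ≤ τ) :
    |erlangTail P.mT (P.mT * τ)| ≤ 1 := by
  have h : 0 ≤ P.mT * τ := mul_nonneg (Nat.cast_nonneg _) hτ
  rw [abs_of_nonneg (erlangTail_nonneg _ h)]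
  exact erlangTail_le_one _ h

/-- Expanding `(σ² + y) ^ k` and splitting the exponential isolates `y ^ (k - p) * exp (-s y)` with
`s = m ε r ^ α`, whose mean is a signed derivative of the Laplace transform. -/
lemma erlangTail_threshold_expand {r y : ℝ} (hr : 0 < r) :
    erlangTail P.mT (P.mT * threshold P (r, y)) =
      ∑ k ∈ Finset.range P.mT, ∑ p ∈ Finset.range (k + 1),
        (k.choose p : ℝ) * (r ^ (P.alphaT * k) * (P.mT * P.epsT) ^ k / (k.factorial : ℝ)) *
          P.noiseT ^ p * Real.exp (-(P.mT * r ^ P.alphaT * P.epsT * P.noiseT)) *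
          (y ^ (k - p) * Real.exp (-(P.mT * P.epsT * r ^ P.alphaT) * y)) := by
  have hexp : Real.exp (-(P.mT * threshold P (r, y))) =
      Real.exp (-(P.mT * r ^ P.alphaT * P.epsT * P.noiseT)) *
        Real.exp (-(P.mT * P.epsT * r ^ P.alphaT) * y) := by
    rw [← Real.exp_add, threshold]
    congr 1
    ring
  rw [erlangTail, hexp, Finset.mul_sum]
  refine Finset.sum_congr rfl fun k _ => ?_
  have hpow : (P.mT * threshold P (r, y)) ^ k =
      r ^ (P.alphaT * k) * (P.mT * P.epsT) ^ k * (P.noiseT + y) ^ k := by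
    rw [Real.rpow_mul_natCast hr.le, ← mul_pow, ← mul_pow, threshold]
    congr 1
    ring
  rw [hpow, add_pow, Finset.mul_sum, Finset.sum_div, Finset.mul_sum]
  refine Finset.sum_congr rfl fun p _ => ?_
  ring

lemma exactTerm_eq [IsProbabilityMeasure μ] {r : ℝ} (hr : 0 < r)
    (hy : ∀ᵐ y ∂(condDistrib N.I N.R μ r), 0 ≤ y) :
    N.exactTerm r = ∫ y, erlangTail P.mT (P.mT * threshold P (r, y))
      ∂(condDistrib N.I N.R μ r) := by
  have hs : 0 < P.mT * P.epsT * r ^ P.alphaT :=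
    mul_pos (mul_pos (by exact_mod_cast P.mT_pos) P.epsT_pos) (Real.rpow_pos_of_pos hr _)
  simp_rw [erlangTail_threshold_expand hr]
  rw [integral_finsetSum _ fun k _ => integrable_finsetSum _ fun p _ =>
    (integrable_pow_mul_exp_neg hy hs _).const_mul _]
  refine Finset.sum_congr rfl fun k _ => ?_
  rw [integral_finsetSum _ fun p _ => (integrable_pow_mul_exp_neg hy hs _).const_mul _]
  refine Finset.sum_congr rfl fun p _ => ?_
  rw [integral_const_mul, ← iteratedDeriv_laplace hy hs]
  rfl

/-! ### Powers of exponential distribution functions -/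

/-- The tail of the distribution function `(1 - exp (-b τ)) ^ m`. -/
noncomputable def expPowTail (m : ℕ) (b τ : ℝ) : ℝ := 1 - (1 - Real.exp (-b * τ)) ^ m

lemma measurable_expPowTail (m : ℕ) (b : ℝ) : Measurable (expPowTail m b) := by
  unfold expPowTail
  fun_prop

lemma abs_expPowTail_le_one (m : ℕ) {b τ : ℝ} (hb : 0 ≤ b) (hτ : 0 ≤ τ) :
    |expPowTail m b τ| ≤ 1 := by
  have h1 : Real.exp (-b * τ) ≤ 1 := by
    rw [Real.exp_le_one_iff]
    nlinarith
  have h2 := Real.exp_pos (-b * τ)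
  have h3 : 0 ≤ (1 - Real.exp (-b * τ)) ^ m := pow_nonneg (by linarith) m
  have h4 : (1 - Real.exp (-b * τ)) ^ m ≤ 1 := pow_le_one₀ (by linarith) (by linarith)
  rw [expPowTail, abs_le]
  constructor <;> linarith

lemma expPowTail_expand (m : ℕ) (b τ : ℝ) :
    expPowTail m b τ = ∑ k ∈ Finset.Icc 1 m,
      (-1) ^ (k + 1) * (m.choose k : ℝ) * Real.exp (-(k * (b * τ))) := by
  -- The `k = 0` term of the binomial expansion cancels the leading `1`.
  have h : Finset.range (m + 1) = insert 0 (Finset.Icc 1 m) := by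
    ext k
    simp only [Finset.mem_range, Finset.mem_insert, Finset.mem_Icc]
    omega
  rw [expPowTail, sub_eq_neg_add (1 : ℝ) (Real.exp _), add_pow, h, Finset.sum_insert (by simp)]
  simp only [pow_zero, one_pow, mul_one, Nat.choose_zero_right, Nat.cast_one,
    sub_add_cancel_left, ← Finset.sum_neg_distrib]
  refine Finset.sum_congr rfl fun k _ => ?_
  rw [neg_pow, ← Real.exp_nat_mul, pow_succ]
  have : (k : ℝ) * (-b * τ) = -(k * (b * τ)) := by ring
  rw [this]
  ring

lemma altTerm_eq [IsProbabilityMeasure μ] {b : ℝ} (hb : 0 ≤ b) {r : ℝ} (hr : 0 < r)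
    (hy : ∀ᵐ y ∂(condDistrib N.I N.R μ r), 0 ≤ y) :
    N.altTerm b r = ∫ y, expPowTail P.mT b (threshold P (r, y)) ∂(condDistrib N.I N.R μ r) := by
  have hexp : ∀ (k : ℕ) (y : ℝ), Real.exp (-(k * (b * threshold P (r, y)))) =
      Real.exp (-(k * b * r ^ P.alphaT * P.epsT * P.noiseT)) *
        Real.exp (-(k * b * r ^ P.alphaT * P.epsT) * y) := by
    intro k y
    rw [← Real.exp_add, threshold]
    congr 1
    ring
  simp_rw [expPowTail_expand, hexp, ← mul_assoc]
  have hint : ∀ k : ℕ, Integrable (fun y => Real.exp (-(k * b * r ^ P.alphaT * P.epsT) * y))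
      (condDistrib N.I N.R μ r) := by
    intro k
    refine Integrable.of_bound (C := 1) (by fun_prop) ?_
    filter_upwards [hy] with y hy
    rw [Real.norm_eq_abs, abs_of_pos (Real.exp_pos _), Real.exp_le_one_iff]
    have := P.epsT_pos
    have : 0 ≤ k * b * r ^ P.alphaT * P.epsT * y := by positivity
    linarith
  rw [integral_finsetSum _ fun k _ => (hint k).const_mul _]
  refine Finset.sum_congr rfl fun k _ => ?_
  rw [integral_const_mul]
  rfl

/-! ### Comparison of the tails -/

lemma expPowTail_le_erlangTail (P : Params) {τ : ℝ} (hτ : 0 ≤ τ) :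
    expPowTail P.mT P.mT τ ≤ erlangTail P.mT (P.mT * τ) := by
  have h := one_sub_one_sub_exp_pow_le_erlangTail P.mT_pos
    (mul_nonneg (Nat.cast_nonneg P.mT) hτ)
  rwa [expPowTail, neg_mul]

lemma erlangTail_le_expPowTail (P : Params) {τ : ℝ} (hτ : 0 ≤ τ) :
    erlangTail P.mT (P.mT * τ) ≤ expPowTail P.mT P.bT τ := by
  have hm : (P.mT : ℝ) ≠ 0 := by exact_mod_cast P.mT_pos.ne'
  have hf : (0 : ℝ) < P.mT.factorial := by positivity
  -- The rate `b_T` is `m * s` for the normalized scale `s = (m!) ^ (-1 / m)` of Alzer's inequality.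
  have hs : ((P.mT.factorial : ℝ) ^ (-(1 : ℝ) / P.mT)) ^ P.mT * P.mT.factorial = 1 := by
    rw [← Real.rpow_mul_natCast hf.le, div_mul_cancel₀ _ hm, Real.rpow_neg_one,
      inv_mul_cancel₀ hf.ne']
  have h := erlangTail_le_one_sub_one_sub_exp_pow P.mT_pos (Real.rpow_pos_of_pos hf _) hs
    (mul_nonneg (Nat.cast_nonneg P.mT) hτ)
  have e : -P.bT * τ = -((P.mT.factorial : ℝ) ^ (-(1 : ℝ) / P.mT) * (P.mT * τ)) := by
    rw [Params.bT]
    ring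
  rwa [expPowTail, e]

end Network

end MmWave

/-! ### The coverage formulas and bounds -/

theorem mainTheorem6 (P : MmWave.Params) {Ω : Type*} [MeasurableSpace Ω]
    (μ : MeasureTheory.Measure Ω) [MeasureTheory.IsProbabilityMeasure μ]
    (N : MmWave.Network P μ) :
    -- association with the mmWave tier has positive probability and the serving distance a density
    (0 < μ N.assocT ∧
      MeasureTheory.HasPDF N.R (ProbabilityTheory.cond μ N.assocT) MeasureTheory.volume) ∧
    -- the exact expression
    (IntervalIntegrable (fun r => N.exactTerm r * N.servingPDF r)
        MeasureTheory.volume 0 P.RB ∧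
      N.coverageT = ∫ r in (0 : ℝ)..P.RB, N.exactTerm r * N.servingPDF r) ∧
    -- the approximate expression: what the approximation of the Gamma distribution function yields
    (IntervalIntegrable (fun r => N.altTerm P.bT r * N.servingPDF r)
        MeasureTheory.volume 0 P.RB ∧
      N.replacedCoverageT P.bT = ∫ r in (0 : ℝ)..P.RB, N.altTerm P.bT r * N.servingPDF r) ∧
    -- its error: it bounds the coverage probability from above, and with rate `m_T` from below
    (N.coverageT ≤ ∫ r in (0 : ℝ)..P.RB, N.altTerm P.bT r * N.servingPDF r) ∧
    (IntervalIntegrable (fun r => N.altTerm P.mT r * N.servingPDF r)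
        MeasureTheory.volume 0 P.RB ∧
      (∫ r in (0 : ℝ)..P.RB, N.altTerm P.mT r * N.servingPDF r) ≤ N.coverageT) := by
  have hbT := P.bT_pos.le
  have hmT : (0 : ℝ) ≤ P.mT := Nat.cast_nonneg _
  have hErl : Measurable fun τ => erlangTail P.mT (P.mT * τ) :=
    (continuous_erlangTail _).measurable.comp (measurable_const_mul _)
  have hErl1 : ∀ τ, 0 ≤ τ → |erlangTail P.mT (P.mT * τ)| ≤ 1 := fun τ =>
    MmWave.Network.abs_erlangTail_le_one P
  have hPow : ∀ b, 0 ≤ b → ∀ τ, 0 ≤ τ → |MmWave.Network.expPowTail P.mT b τ| ≤ 1 :=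
    fun b hb τ => MmWave.Network.abs_expPowTail_le_one P.mT hb
  have hPowm := fun b => MmWave.Network.measurable_expPowTail P.mT b
  have hτ := N.cond_assocT_absolutelyContinuous.ae_le N.ae_threshold_nonneg
  obtain ⟨hexI, hex⟩ := N.intervalIntegral_mul_servingPDF hErl hErl1 (f := N.exactTerm)
    fun r hr hy => N.exactTerm_eq hr hy
  obtain ⟨haltI, halt⟩ := N.intervalIntegral_mul_servingPDF (hPowm P.bT) (hPow _ hbT)
    (f := N.altTerm P.bT) fun r hr hy => N.altTerm_eq hbT hr hy
  obtain ⟨hlowI, hlow⟩ := N.intervalIntegral_mul_servingPDF (hPowm P.mT) (hPow _ hmT)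
    (f := N.altTerm P.mT) fun r hr hy => N.altTerm_eq hmT hr hy
  refine ⟨⟨N.measure_assocT_pos, N.hasPDF_R⟩, ⟨hexI, N.coverageT_eq.trans hex⟩,
    ⟨haltI, halt⟩, ?_, hlowI, ?_⟩
  · rw [← halt, N.coverageT_eq]
    refine integral_mono_ae (N.integrable_cond_comp_threshold hErl hErl1)
      (N.integrable_cond_comp_threshold (hPowm _) (hPow _ hbT)) ?_
    filter_upwards [hτ] with ω hω using MmWave.Network.erlangTail_le_expPowTail P hω
  · rw [← hlow, N.coverageT_eq]
    refine integral_mono_ae (N.integrable_cond_comp_threshold (hPowm _) (hPow _ hmT))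
      (N.integrable_cond_comp_threshold hErl hErl1) ?_
    filter_upwards [hτ] with ω hω using MmWave.Network.expPowTail_le_erlangTail P hω
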